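/- \textbf{Conventions.} Let $(\Omega,\mathcal B,\mu)$ be a $\sigma$-finite measure space. $\mathrm{MALG}(\mu)$ is the Boolean algebra of measurable sets modulo null sets, and $\mathrm{Aut}^*(\mu)$ is the group of automorphisms of this Boolean algebra, with the topology induced by the Koopman representation $$(g\cdot f)(x)=\Big(\frac{d g_*\mu}{d\mu}\Big)^{1/2}(x)\,f(g^{-1}x),\qquad g\in\mathrm{Aut}^*(\mu),\ f\in L^2(\Omega,\mu),$$ from the strong operator topology on the unitary group of the complex Hilbert space $L^2(\Omega,\mu)$. A \emph{non-singular action} of a topological group $G$ on $(\Omega,\mathcal B,\mu)$ is a continuous homomorphism $G\to\mathrm{Aut}^*(\mu)$. It \emph{preserves} a measure $\nu\ll\mu$ if $\nu(g\cdot E)=\nu(E)$ for all $g\in G$, $E\in\mathrm{MALG}(\mu)$; it is \emph{measure-preserving} if it preserves $\mu$; it is \emph{ergodic} if its only fixed points in $\mathrm{MALG}(\mu)$ are $0$ and $1$. Two actions are \emph{isomorphic} if there is a $G$-equivariant isomorphism of their measure algebras. The \emph{disjoint union} of countably many actions on $(\Omega_i,\mu_i)$ is the action on $\bigsqcup_i\Omega_i$,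 with measure $\sum_i\mu_i$, given by $g\cdot\bigsqcup_i A_i=\bigsqcup_i g\cdot A_i$. If $V\le G$ is an open subgroup of countable index and $\alpha$ is a non-singular action of $V$ on $(\Omega,\mu)$, the \emph{induced action} $\mathrm{Ind}_V^G(\alpha)$ is the action of $G$ on $G/V\times\Omega$, with the product of the counting measure and $\mu$, given by $$g\cdot(\{hV\}\times A)=\{ghV\}\times \alpha\big(s(ghV)^{-1}\,g\,s(hV)\big)\cdot A,$$ where $s\colon G/V\to G$ is a section of the quotient map (up to isomorphism, the action does not depend on $s$). A topological group $G$ is \emph{non-archimedean} if the open subgroups form a basis of neighbourhoods of $1_G$, and \emph{Roelcke precompact} if for every neighbourhood $U$ of $1_G$ there is a finite $F\subseteq G$ with $G=UFU$. A subgroup $V\le G$ is \emph{self-commensurating} if every $g\in G$ for which $V\cap gVg^{-1}$ has finite index in both $V$ and $gVg^{-1}$ belongs to $V$. \textbf{Theorem.} Let $G$ be a Roelcke precompact, non-archimedean, Polish group and let $G\curvearrowright(\Omega,\mathcal B,\mu)$ be a non-singular action on a $\sigma$-finite measure space. Then there exist countably many (possibly zero) self-commensurating, open subgroups $(V_i)_{i\in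 I}$ of $G$ and measure-preserving non-singular actions $V_i\curvearrowright^{\alpha_i}(\Omega_i,\mathcal B_i,\mu_i)$, with each $\mu_i$ a probability measure, such that the action $G\curvearrowright\Omega$ is isomorphic to the disjoint union $$\bigsqcup_{i\in I}\mathrm{Ind}_{V_i}^G(\alpha_i).$$ In particular, there is a $\sigma$-finite measure equivalent to $\mu$ which is preserved by the action; the action is isomorphic to a measure-preserving non-singular action on a $\sigma$-finite (possibly infinite) measure space; and if the action is ergodic and $\mu\neq 0$, then it is isomorphic to $\mathrm{Ind}_V^G(\alpha)$ for some self-commensurating, open subgroup $V$ of $G$ and some measure-preserving non-singular action $\alpha$ of $V$ on a probability space. -/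

import Mathlib

open MeasureTheory Set Filter Topology
open scoped ENNReal Pointwise

universe u v w

noncomputable section

namespace NonsingularActions

/-! ### Topological groups -/

/-- A topological group is Roelcke precompact if for every neighbourhood `U` of the identity
there is a finite set `F` with `G = U F U`. -/
def IsRoelckePrecompact (G : Type u) [Group G] [TopologicalSpace G] : Prop :=
  ∀ U ∈ 𝓝 (1 : G), ∃ F : Set G, F.Finite ∧ U * F * U = Set.univ

/-- A subgroup is self-commensurating if it is equal to its commensurator. -/
def IsSelfCommensurating {G : Type u} [Group G] (V : Subgroup G) : Prop :=
  Subgroup.Commensurable.commensurator V = V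

/-! ### The measure algebra -/

/-- Equality of measurable sets modulo null sets. -/
def nullSetoid {Ω : Type v} [MeasurableSpace Ω] (μ : Measure Ω) :
    Setoid {s : Set Ω // MeasurableSet s} where
  r s t := (s : Set Ω) =ᵐ[μ] (t : Set Ω)
  iseqv := ⟨fun _ => EventuallyEq.rfl, fun h => h.symm, fun h₁ h₂ => h₁.trans h₂⟩

/-- The measure algebra of `μ`: measurable sets modulo null sets. -/
def MeasureAlgebra {Ω : Type v} [MeasurableSpace Ω] (μ : Measure Ω) : Type v :=
  Quotient (nullSetoid μ)

namespace MeasureAlgebra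

section

variable {Ω : Type v} [MeasurableSpace Ω] {μ : Measure Ω}

/-- The class of a measurable set in the measure algebra. -/
def mk (μ : Measure Ω) (s : Set Ω) (hs : MeasurableSet s) : MeasureAlgebra μ :=
  Quotient.mk (nullSetoid μ) ⟨s, hs⟩

theorem exists_rep (a : MeasureAlgebra μ) : ∃ s, ∃ hs : MeasurableSet s, mk μ s hs = a := by
  induction a using Quotient.inductionOn with
  | h s => exact ⟨s.1, s.2, rfl⟩

theorem mk_eq_mk {s t : Set Ω} {hs : MeasurableSet s} {ht : MeasurableSet t} :
    mk μ s hs = mk μ t ht ↔ s =ᵐ[μ] t :=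
  ⟨fun h => Quotient.exact (s := nullSetoid μ) h, fun h => Quotient.sound (s := nullSetoid μ) h⟩

/-- The Boolean algebra structure is the one of sets, modulo null sets. -/
instance instPartialOrder : PartialOrder (MeasureAlgebra μ) where
  le := Quotient.lift₂ (fun s t => (s : Set Ω) ≤ᵐ[μ] (t : Set Ω)) (by
    intro s t s' t' hs ht
    exact propext ⟨fun h => (hs.symm.le.trans h).trans ht.le,
      fun h => (hs.le.trans h).trans ht.symm.le⟩)
  le_refl a := by
    induction a using Quotient.inductionOn with
    | h s => exact EventuallyLE.rfl
  le_trans a b c := by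
    induction a, b using Quotient.inductionOn₂ with
    | h s t =>
      induction c using Quotient.inductionOn with
      | h r => exact fun h₁ h₂ => EventuallyLE.trans h₁ h₂
  le_antisymm a b := by
    induction a, b using Quotient.inductionOn₂ with
    | h s t => exact fun h₁ h₂ => Quotient.sound (s := nullSetoid μ) (EventuallyLE.antisymm h₁ h₂)

theorem mk_le_mk {s t : Set Ω} {hs : MeasurableSet s} {ht : MeasurableSet t} :
    mk μ s hs ≤ mk μ t ht ↔ s ≤ᵐ[μ] t := Iff.rfl

instance instBooleanAlgebra : BooleanAlgebra (MeasureAlgebra μ) where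
  __ := instPartialOrder
  sup := Quotient.lift₂ (fun s t => mk μ ((s : Set Ω) ∪ t) (s.2.union t.2)) (by
    intro s t s' t' hs ht
    exact mk_eq_mk.2 (EventuallyEq.union hs ht))
  inf := Quotient.lift₂ (fun s t => mk μ ((s : Set Ω) ∩ t) (s.2.inter t.2)) (by
    intro s t s' t' hs ht
    exact mk_eq_mk.2 (EventuallyEq.inter hs ht))
  compl := Quotient.lift (fun s => mk μ (s : Set Ω)ᶜ s.2.compl) (by
    intro s t h
    exact mk_eq_mk.2 (EventuallyEq.compl h))
  top := mk μ Set.univ MeasurableSet.univ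
  bot := mk μ ∅ MeasurableSet.empty
  le_sup_left a b := by
    induction a, b using Quotient.inductionOn₂ with
    | h s t => exact mk_le_mk.2 (Eventually.of_forall fun x hx => Or.inl hx)
  le_sup_right a b := by
    induction a, b using Quotient.inductionOn₂ with
    | h s t => exact mk_le_mk.2 (Eventually.of_forall fun x hx => Or.inr hx)
  sup_le a b c := by
    induction a, b using Quotient.inductionOn₂ with
    | h s t =>
      induction c using Quotient.inductionOn with
      | h r =>
        intro h₁ h₂
        refine mk_le_mk.2 ?_
        have h₁' : (s : Set Ω) ≤ᵐ[μ] (r : Set Ω) := h₁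
        have h₂' : (t : Set Ω) ≤ᵐ[μ] (r : Set Ω) := h₂
        filter_upwards [h₁', h₂'] with x h₁ h₂ hx
        exact hx.elim h₁ h₂
  inf_le_left a b := by
    induction a, b using Quotient.inductionOn₂ with
    | h s t => exact mk_le_mk.2 (Eventually.of_forall fun x hx => hx.1)
  inf_le_right a b := by
    induction a, b using Quotient.inductionOn₂ with
    | h s t => exact mk_le_mk.2 (Eventually.of_forall fun x hx => hx.2)
  le_inf a b c := by
    induction a, b using Quotient.inductionOn₂ with
    | h s t =>
      induction c using Quotient.inductionOn with
      | h r =>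
        intro h₁ h₂
        refine mk_le_mk.2 ?_
        have h₁' : (s : Set Ω) ≤ᵐ[μ] (t : Set Ω) := h₁
        have h₂' : (s : Set Ω) ≤ᵐ[μ] (r : Set Ω) := h₂
        filter_upwards [h₁', h₂'] with x h₁ h₂ hx
        exact ⟨h₁ hx, h₂ hx⟩
  le_sup_inf a b c := by
    induction a, b using Quotient.inductionOn₂ with
    | h s t =>
      induction c using Quotient.inductionOn with
      | h r =>
        refine mk_le_mk.2 (Eventually.of_forall fun x hx => ?_)
        rcases hx with ⟨h₁ | h₁, h₂ | h₂⟩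
        · exact Or.inl h₁
        · exact Or.inl h₁
        · exact Or.inl h₂
        · exact Or.inr ⟨h₁, h₂⟩
  inf_compl_le_bot a := by
    induction a using Quotient.inductionOn with
    | h s => exact mk_le_mk.2 (Eventually.of_forall fun x hx => hx.2 hx.1)
  top_le_sup_compl a := by
    induction a using Quotient.inductionOn with
    | h s => exact mk_le_mk.2 (Eventually.of_forall fun x _ => em (x ∈ (s : Set Ω)))
  le_top a := by
    induction a using Quotient.inductionOn with
    | h s => exact mk_le_mk.2 (Eventually.of_forall fun x _ => trivial)
  bot_le a := by
    induction a using Quotient.inductionOn with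
    | h s => exact mk_le_mk.2 (Eventually.of_forall fun x hx => hx.elim)

theorem mk_inf_mk {s t : Set Ω} (hs : MeasurableSet s) (ht : MeasurableSet t) :
    mk μ s hs ⊓ mk μ t ht = mk μ (s ∩ t) (hs.inter ht) := rfl

theorem compl_mk {s : Set Ω} (hs : MeasurableSet s) :
    (mk μ s hs)ᶜ = mk μ sᶜ hs.compl := rfl

theorem top_eq : (⊤ : MeasureAlgebra μ) = mk μ Set.univ MeasurableSet.univ := rfl

theorem bot_eq : (⊥ : MeasureAlgebra μ) = mk μ ∅ MeasurableSet.empty := rfl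

theorem isLUB_iUnion (s : ℕ → Set Ω) (hs : ∀ n, MeasurableSet (s n)) :
    IsLUB (Set.range fun n => mk μ (s n) (hs n)) (mk μ (⋃ n, s n) (MeasurableSet.iUnion hs)) := by
  constructor
  · rintro _ ⟨n, rfl⟩
    exact mk_le_mk.2 (Eventually.of_forall fun x hx => Set.mem_iUnion.2 ⟨n, hx⟩)
  · intro b hb
    obtain ⟨t, ht, rfl⟩ := exists_rep b
    have h : ∀ n, s n ≤ᵐ[μ] t := fun n => mk_le_mk.1 (hb ⟨n, rfl⟩)
    refine mk_le_mk.2 ?_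
    filter_upwards [ae_all_iff.2 h] with x hx hx'
    obtain ⟨n, hn⟩ := Set.mem_iUnion.1 hx'
    exact hx n hn

/-- The value on an element of the measure algebra of `μ` of a measure `ν` which is absolutely
continuous with respect to `μ`. -/
def value (ν : Measure Ω) (h : ν ≪ μ) : MeasureAlgebra μ → ℝ≥0∞ :=
  Quotient.lift (fun s => ν (s : Set Ω)) fun _ _ hst => measure_congr (h.ae_le hst)

@[simp] theorem value_mk (ν : Measure Ω) (h : ν ≪ μ) {s : Set Ω} (hs : MeasurableSet s) :
    value ν h (mk μ s hs) = ν s := rfl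

end

end MeasureAlgebra

/-- `Aut*(μ)`: the group of automorphisms of the Boolean algebra of measurable sets modulo
null sets (the multiplication is composition). -/
abbrev AutStar {Ω : Type v} [MeasurableSpace Ω] (μ : Measure Ω) : Type v :=
  MeasureAlgebra μ ≃o MeasureAlgebra μ

namespace AutStar

open MeasureAlgebra

section

variable {Ω : Type v} [MeasurableSpace Ω] {μ : Measure Ω}

/-- The push-forward `g_* μ`, that is, `E ↦ μ (g⁻¹ E)`, of `μ` under `g ∈ Aut*(μ)`. -/
def push (g : AutStar μ) : Measure Ω :=
  Measure.ofMeasurable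
    (fun s hs => value μ Measure.AbsolutelyContinuous.rfl (g.symm (mk μ s hs)))
    (by
      have : g.symm (mk μ ∅ MeasurableSet.empty) = ⊥ := map_bot g.symm
      simp only [this, bot_eq, value_mk, measure_empty])
    (by
      intro s hs hd
      choose t ht hst using fun n => exists_rep (g.symm (mk μ (s n) (hs n)))
      have h1 := (isLUB_iUnion (μ := μ) s hs)
      have h2 : IsLUB (Set.range fun n => mk μ (t n) (ht n))
          (g.symm (mk μ (⋃ n, s n) (MeasurableSet.iUnion hs))) := by
        have := (OrderIso.isLUB_image' g.symm).2 h1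
        rw [← Set.range_comp] at this
        simpa only [hst, Function.comp_def] using this
      rw [h2.unique (isLUB_iUnion t ht), value_mk, measure_iUnion₀]
      · simp only [← hst, value_mk]
      · intro m n hmn
        have h3 : mk μ (t m ∩ t n) ((ht m).inter (ht n)) = mk μ ∅ MeasurableSet.empty := by
          rw [← mk_inf_mk (ht m) (ht n), hst, hst, ← OrderIso.map_inf, mk_inf_mk]
          have : mk μ (s m ∩ s n) ((hs m).inter (hs n)) = ⊥ := by
            rw [bot_eq, mk_eq_mk, (hd hmn).inter_eq]
            exact EventuallyEq.rfl
          rw [this, OrderIso.map_bot, bot_eq]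
        have h4 := mk_eq_mk.1 h3
        exact ae_eq_empty.1 h4
      · exact fun n => (ht n).nullMeasurableSet)

theorem push_apply (g : AutStar μ) {s : Set Ω} (hs : MeasurableSet s) :
    push g s = value μ Measure.AbsolutelyContinuous.rfl (g.symm (mk μ s hs)) :=
  Measure.ofMeasurable_apply s hs

/-- Every automorphism of the measure algebra acts on complex measurable functions. -/
theorem exists_transport (g : AutStar μ) (f : Ω → ℂ) (hf : Measurable f) :
    ∃ k : Ω → ℂ, ∃ hk : Measurable k, ∀ (B : Set ℂ) (hB : MeasurableSet B),
      mk μ (k ⁻¹' B) (hk hB) = g (mk μ (f ⁻¹' B) (hf hB)) := by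
  obtain ⟨e, he, hinj⟩ := MeasurableSpace.measurable_injection_nat_bool_of_countablySeparated ℂ
  have hemb : MeasurableEmbedding e := he.measurableEmbedding hinj
  have hc : ∀ n : ℕ, MeasurableSet {b : ℕ → Bool | b n = true} := fun n =>
    (measurable_pi_apply (X := fun _ : ℕ => Bool) n) (t := {true}) (MeasurableSet.singleton true)
  have hef : Measurable (e ∘ f) := he.comp hf
  choose t ht hst using fun n => exists_rep (g (mk μ ((e ∘ f) ⁻¹' {b | b n = true}) (hef (hc n))))
  classical
  let k : Ω → ℕ → Bool := fun x n => decide (x ∈ t n)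
  have hkm : Measurable k := by
    refine measurable_pi_lambda _ fun n => ?_
    refine measurable_to_bool ?_
    have : (fun x => k x n) ⁻¹' {true} = t n := by ext x; simp [k]
    rw [this]
    exact ht n
  have key : ∀ (B : Set (ℕ → Bool)) (hB : MeasurableSet B),
      mk μ (k ⁻¹' B) (hkm hB) = g (mk μ ((e ∘ f) ⁻¹' B) (hef hB)) := by
    have hgen : (MeasurableSpace.pi : MeasurableSpace (ℕ → Bool)) =
        MeasurableSpace.generateFrom (Set.range fun n : ℕ => {b : ℕ → Bool | b n = true}) := by
      apply le_antisymm
      · refine iSup_le fun n => ?_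
        rw [← measurable_iff_comap_le]
        let _ : MeasurableSpace (ℕ → Bool) :=
          MeasurableSpace.generateFrom (Set.range fun n : ℕ => {b : ℕ → Bool | b n = true})
        exact measurable_to_bool (MeasurableSpace.measurableSet_generateFrom ⟨n, rfl⟩)
      · refine MeasurableSpace.generateFrom_le ?_
        rintro _ ⟨n, rfl⟩
        exact hc n
    intro B hB
    have hB' : MeasurableSet[MeasurableSpace.generateFrom
        (Set.range fun n : ℕ => {b : ℕ → Bool | b n = true})] B := hgen ▸ hB
    induction B, hB' using MeasurableSpace.generateFrom_induction with
    | hC s hs _ =>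
      obtain ⟨n, rfl⟩ := hs
      rw [← hst n, mk_eq_mk]
      refine Eventually.of_forall fun x => ?_
      have : k ⁻¹' {b | b n = true} = t n := by ext x; simp [k]
      exact congrFun this x
    | empty => exact (map_bot g).symm
    | compl s hs ih =>
      have h1 : MeasurableSet s := hgen ▸ hs
      have := congrArg (fun a => aᶜ) (ih h1)
      simp only [← map_compl', compl_mk] at this
      exact this
    | iUnion s hs ih =>
      have h1 : ∀ n, MeasurableSet (s n) := fun n => hgen ▸ hs n
      have a1 := isLUB_iUnion (μ := μ) (fun n => (e ∘ f) ⁻¹' s n) fun n => hef (h1 n)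
      have a2 := isLUB_iUnion (μ := μ) (fun n => k ⁻¹' s n) fun n => hkm (h1 n)
      have a3 := (OrderIso.isLUB_image' g).2 a1
      rw [← Set.range_comp] at a3
      simp only [Function.comp_def, ih _ (h1 _)] at a2 a3
      have := a2.unique a3
      simpa only [Set.preimage_iUnion, Function.comp_def] using this
  refine ⟨hemb.invFun ∘ k, hemb.measurable_invFun.comp hkm, fun B hB => ?_⟩
  have hr : ∀ᵐ x ∂μ, k x ∈ Set.range e := by
    have h1 := key _ hemb.measurableSet_range
    have h2 : (e ∘ f) ⁻¹' Set.range e = Set.univ := by ext x; simp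
    simp only [h2] at h1
    have h3 : g (mk μ Set.univ MeasurableSet.univ) = ⊤ := map_top g
    rw [h3, top_eq, mk_eq_mk] at h1
    filter_upwards [h1] with x hx
    have : k ⁻¹' Set.range e = _ := rfl
    exact hx.mpr trivial
  have h1 := key _ (hemb.measurableSet_image.2 hB)
  have h2 : (e ∘ f) ⁻¹' (e '' B) = f ⁻¹' B := by
    rw [Set.preimage_comp, Set.preimage_image_eq _ hinj]
  simp only [h2] at h1
  rw [← h1, mk_eq_mk]
  filter_upwards [hr] with x hx
  obtain ⟨z, hz⟩ := hx
  apply propext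
  show hemb.invFun (k x) ∈ B ↔ k x ∈ e '' B
  rw [← hz, hemb.leftInverse_invFun z, hinj.mem_set_image]

/-- The function `x ↦ f (g⁻¹ x)`: the function, unique up to equality almost everywhere, for
which `{x | f (g⁻¹ x) ∈ B} = g {x | f x ∈ B}` modulo null sets, for all Borel sets `B`. -/
def transport (g : AutStar μ) (f : Ω → ℂ) (hf : Measurable f) : Ω → ℂ :=
  (exists_transport g f hf).choose

theorem measurable_transport (g : AutStar μ) (f : Ω → ℂ) (hf : Measurable f) :
    Measurable (transport g f hf) := (exists_transport g f hf).choose_spec.choose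

theorem transport_spec (g : AutStar μ) (f : Ω → ℂ) (hf : Measurable f) {B : Set ℂ}
    (hB : MeasurableSet B) :
    mk μ (transport g f hf ⁻¹' B) (measurable_transport g f hf hB) =
      g (mk μ (f ⁻¹' B) (hf hB)) :=
  (exists_transport g f hf).choose_spec.choose_spec B hB

theorem transport_unique (g : AutStar μ) (f : Ω → ℂ) (hf : Measurable f) (k : Ω → ℂ)
    (hk : Measurable k) (h : ∀ (B : Set ℂ) (hB : MeasurableSet B),
      mk μ (k ⁻¹' B) (hk hB) = g (mk μ (f ⁻¹' B) (hf hB))) :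
    k =ᵐ[μ] transport g f hf := by
  refine Filter.EventuallyEq.of_forall_separating_preimage MeasurableSet fun B hB => ?_
  exact mk_eq_mk.1 ((h B hB).trans (transport_spec g f hf hB).symm)

theorem map_transport (g : AutStar μ) (f : Ω → ℂ) (hf : Measurable f) :
    (push g).map (transport g f hf) = μ.map f := by
  ext B hB
  rw [Measure.map_apply (measurable_transport g f hf) hB, Measure.map_apply hf hB,
    push_apply g (measurable_transport g f hf hB), transport_spec g f hf hB,
    OrderIso.symm_apply_apply, value_mk]

/-- The function `x ↦ (d(g_* μ)/dμ)^{1/2}(x) f (g⁻¹ x)`. -/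
def koopmanFun (g : AutStar μ) (f : Ω → ℂ) (hf : Measurable f) : Ω → ℂ :=
  fun x => (Real.sqrt ((push g).rnDeriv μ x).toReal : ℂ) * transport g f hf x

theorem memLp_koopmanFun (g : AutStar μ) (f : Lp ℂ 2 μ) :
    MemLp (koopmanFun g f (Lp.stronglyMeasurable f).measurable) 2 μ := by
  set hf := (Lp.stronglyMeasurable f).measurable
  have hm := measurable_transport g f hf
  have hr := (push g).measurable_rnDeriv μ
  refine ⟨Measurable.aestronglyMeasurable ?_, ?_⟩
  · unfold koopmanFun
    fun_prop
  rw [eLpNorm_lt_top_iff_lintegral_rpow_enorm_lt_top two_ne_zero ENNReal.ofNat_ne_top]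
  have hfin := (eLpNorm_lt_top_iff_lintegral_rpow_enorm_lt_top two_ne_zero
    ENNReal.ofNat_ne_top).1 (Lp.memLp f).2
  refine lt_of_le_of_lt ?_ hfin
  have hn : Measurable fun z : ℂ => ‖z‖ₑ ^ (2 : ℝ≥0∞).toReal := by fun_prop
  calc ∫⁻ x, ‖koopmanFun g f hf x‖ₑ ^ (2 : ℝ≥0∞).toReal ∂μ
      ≤ ∫⁻ x, (push g).rnDeriv μ x * ‖transport g f hf x‖ₑ ^ (2 : ℝ≥0∞).toReal ∂μ := by
        refine lintegral_mono fun x => ?_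
        simp only [koopmanFun, enorm_mul, ENNReal.toReal_ofNat]
        rw [ENNReal.mul_rpow_of_nonneg _ _ zero_le_two]
        gcongr
        rw [← ofReal_norm, Complex.norm_real, Real.norm_of_nonneg (Real.sqrt_nonneg _),
          ENNReal.ofReal_rpow_of_nonneg (Real.sqrt_nonneg _) zero_le_two, Real.rpow_two,
          Real.sq_sqrt ENNReal.toReal_nonneg]
        exact ENNReal.ofReal_toReal_le
    _ = ∫⁻ x, ‖transport g f hf x‖ₑ ^ (2 : ℝ≥0∞).toReal
          ∂(μ.withDensity ((push g).rnDeriv μ)) :=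
        (lintegral_withDensity_eq_lintegral_mul _ hr (hn.comp hm)).symm
    _ ≤ ∫⁻ x, ‖transport g f hf x‖ₑ ^ (2 : ℝ≥0∞).toReal ∂(push g) :=
        lintegral_mono' (Measure.withDensity_rnDeriv_le _ _) le_rfl
    _ = ∫⁻ x, ‖f x‖ₑ ^ (2 : ℝ≥0∞).toReal ∂μ := by
        rw [← lintegral_map hn hm, map_transport, lintegral_map hn hf]

/-- The Koopman representation of `Aut*(μ)` on `L²(Ω, μ)`. -/
def koopman (g : AutStar μ) (f : Lp ℂ 2 μ) : Lp ℂ 2 μ :=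
  (memLp_koopmanFun g f).toLp _

/-- The topology of `Aut*(μ)` is the one induced by the Koopman representation from the
strong operator topology, i.e., the topology of pointwise convergence on `L²(Ω, μ)`. -/
instance instTopologicalSpace : TopologicalSpace (AutStar μ) :=
  TopologicalSpace.induced (fun g => (koopman g : Lp ℂ 2 μ → Lp ℂ 2 μ)) Pi.topologicalSpace

end

end AutStar

/-! ### Non-singular actions -/

/-- A non-singular action of a topological group `G` on `(Ω, μ)`: a continuous homomorphism
from `G` to `Aut*(μ)`. -/
abbrev NonsingularAction (G : Type u) [Group G] [TopologicalSpace G] {Ω : Type v}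
    [MeasurableSpace Ω] (μ : Measure Ω) : Type (max u v) :=
  G →ₜ* AutStar μ

/-- The action preserves the measure `ν`, where `ν` is absolutely continuous with respect
to `μ`. -/
def Preserves {G : Type u} [Group G] {Ω : Type v} [MeasurableSpace Ω] {μ : Measure Ω}
    (π : G →* AutStar μ) (ν : Measure Ω) (h : ν ≪ μ) : Prop :=
  ∀ (g : G) (E : MeasureAlgebra μ),
    MeasureAlgebra.value ν h (π g E) = MeasureAlgebra.value ν h E

/-- The action preserves the measure `μ` (and not only the measure class of `μ`). -/
def IsMeasurePreserving {G : Type u} [Group G] {Ω : Type v} [MeasurableSpace Ω] {μ : Measure Ω}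
    (π : G →* AutStar μ) : Prop :=
  Preserves π μ Measure.AbsolutelyContinuous.rfl

/-- The action is ergodic if its only fixed points in the measure algebra are `0` and `1`. -/
def IsErgodic {G : Type u} [Group G] {Ω : Type v} [MeasurableSpace Ω] {μ : Measure Ω}
    (π : G →* AutStar μ) : Prop :=
  ∀ E : MeasureAlgebra μ, (∀ g : G, π g E = E) → E = ⊥ ∨ E = ⊤

/-- Two actions are isomorphic if there is an equivariant isomorphism of the measure algebras. -/
def Isomorphic {G : Type u} [Group G] {Ω : Type v} [MeasurableSpace Ω] {μ : Measure Ω}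
    {Ω' : Type w} [MeasurableSpace Ω'] {ν : Measure Ω'}
    (π : G →* AutStar μ) (ρ : G →* AutStar ν) : Prop :=
  ∃ Φ : MeasureAlgebra μ ≃o MeasureAlgebra ν,
    ∀ (g : G) (E : MeasureAlgebra μ), Φ (π g E) = ρ g (Φ E)

/-! ### Disjoint unions -/

section

variable {ι : Type w} {Ω : ι → Type v} [∀ i, MeasurableSpace (Ω i)]

/-- The measure `∑ i, μ i` on the disjoint union of the spaces `Ω i`. -/
def sigmaMeasure (μ : ∀ i, Measure (Ω i)) : Measure (Σ i, Ω i) :=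
  Measure.sum fun i => (μ i).map (Sigma.mk i)

theorem measurable_sigmaMk (i : ι) : Measurable (Sigma.mk i : Ω i → Σ i, Ω i) :=
  fun _ hs => (MeasurableSpace.measurableSet_iInf.1 hs) i

theorem sigmaMeasure_apply (μ : ∀ i, Measure (Ω i)) {s : Set (Σ i, Ω i)} (hs : MeasurableSet s) :
    sigmaMeasure μ s = ∑' i, μ i (Sigma.mk i ⁻¹' s) := by
  rw [sigmaMeasure, Measure.sum_apply _ hs]
  exact tsum_congr fun i => Measure.map_apply (measurable_sigmaMk i) hs

theorem sigma_ae_le_iff (μ : ∀ i, Measure (Ω i)) {s t : Set (Σ i, Ω i)}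
    (hs : MeasurableSet s) (ht : MeasurableSet t) :
    s ≤ᵐ[sigmaMeasure μ] t ↔ ∀ i, Sigma.mk i ⁻¹' s ≤ᵐ[μ i] Sigma.mk i ⁻¹' t := by
  simp only [ae_le_set]
  rw [sigmaMeasure_apply μ (hs.diff ht), ENNReal.tsum_eq_zero]
  rfl

/-- The measure algebra of a disjoint union is the product of the measure algebras: a measurable
subset of the disjoint union corresponds to the family of its traces on the pieces. -/
def sigmaEquiv (μ : ∀ i, Measure (Ω i)) :
    MeasureAlgebra (sigmaMeasure μ) ≃o (∀ i, MeasureAlgebra (μ i)) :=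
  let F : MeasureAlgebra (sigmaMeasure μ) → ∀ i, MeasureAlgebra (μ i) :=
    Quotient.lift (fun s i => MeasureAlgebra.mk (μ i) (Sigma.mk i ⁻¹' (s : Set (Σ i, Ω i)))
      (measurable_sigmaMk i s.2)) (fun s t h => funext fun i => le_antisymm
        (MeasureAlgebra.mk_le_mk.2 ((sigma_ae_le_iff μ s.2 t.2).1 (EventuallyEq.le h) i))
        (MeasureAlgebra.mk_le_mk.2 ((sigma_ae_le_iff μ t.2 s.2).1
          (EventuallyEq.le (EventuallyEq.symm h)) i)))
  have hF : ∀ {a b}, F a ≤ F b ↔ a ≤ b := by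
    intro a b
    obtain ⟨s, hs, rfl⟩ := a.exists_rep
    obtain ⟨t, ht, rfl⟩ := b.exists_rep
    exact (sigma_ae_le_iff μ hs ht).symm
  have hsurj : Function.Surjective F := by
    intro b
    choose s hs hb using fun i => (b i).exists_rep
    exact ⟨MeasureAlgebra.mk _ {p | p.2 ∈ s p.1} (MeasurableSpace.measurableSet_iInf.2 hs),
      funext hb⟩
  { toEquiv := Equiv.ofBijective F ⟨fun a b h => le_antisymm (hF.1 h.le) (hF.1 h.ge), hsurj⟩
    map_rel_iff' := hF }

theorem sigmaEquiv_mk (μ : ∀ i, Measure (Ω i)) {s : Set (Σ i, Ω i)} (hs : MeasurableSet s)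
    (i : ι) : sigmaEquiv μ (MeasureAlgebra.mk _ s hs) i =
      MeasureAlgebra.mk (μ i) (Sigma.mk i ⁻¹' s) (measurable_sigmaMk i hs) := rfl

/-- A family of automorphisms acts on the product coordinatewise. -/
def piIso {α : ι → Type v} [∀ i, PartialOrder (α i)] (f : ∀ i, α i ≃o α i) :
    (∀ i, α i) ≃o (∀ i, α i) where
  toFun A i := f i (A i)
  invFun A i := (f i).symm (A i)
  left_inv A := by
    ext i
    simp
  right_inv A := by
    ext i
    simp
  map_rel_iff' := by
    intro A B
    simp [Pi.le_def]

@[simp] theorem piIso_apply {α : ι → Type v} [∀ i, PartialOrder (α i)] (f : ∀ i, α i ≃o α i)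
    (A : ∀ i, α i) (i : ι) : piIso f A i = f i (A i) := rfl

/-- The disjoint union of a family of actions: `g (⨆ i, A i) = ⨆ i, g (A i)`. -/
def disjointUnion {G : Type u} [Group G] {μ : ∀ i, Measure (Ω i)}
    (π : ∀ i, G →* AutStar (μ i)) : G →* AutStar (sigmaMeasure μ) :=
  MonoidHom.mk' (fun g =>
      (sigmaEquiv μ).trans ((piIso fun i => π i g).trans (sigmaEquiv μ).symm))
    (by
      intro g h
      ext E
      apply (sigmaEquiv μ).injective
      ext i
      simp [RelIso.mul_apply])

end

/-! ### Induced actions -/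

section

variable {G : Type u} [Group G]

/-- The cocycle `c (g, x) = s (g x)⁻¹ g s (x)` associated with the section `s : G ⧸ V → G`
which picks a representative of every coset. -/
def cocycle (V : Subgroup G) (g : G) (x : G ⧸ V) : V :=
  ⟨(g • x).out⁻¹ * g * x.out, by
    rw [mul_assoc, ← QuotientGroup.eq, QuotientGroup.out_eq', ← smul_eq_mul,
      MulAction.Quotient.coe_smul_out]⟩

theorem cocycle_mul (V : Subgroup G) (g h : G) (x : G ⧸ V) :
    cocycle V (g * h) x = cocycle V g (h • x) * cocycle V h x := by
  ext
  simp only [cocycle, mul_smul, Subgroup.coe_mul]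
  group

variable {Ω : Type v} [MeasurableSpace Ω]

/-- The space of the induced action: `G ⧸ V × Ω` with the product of the counting measure and
`μ`, written as the disjoint union of copies of `(Ω, μ)` indexed by the discrete set `G ⧸ V`. -/
abbrev inducedMeasure (V : Subgroup G) (μ : Measure Ω) : Measure (Σ _ : G ⧸ V, Ω) :=
  sigmaMeasure fun _ : G ⧸ V => μ

/-- The action on families of elements of the measure algebra of `μ` which sends the piece `A` at
the coset `x` to the piece `c (g, x) A` at the coset `g x`. -/
def inducedPi (V : Subgroup G) {μ : Measure Ω} (σ : V →* AutStar μ) (g : G) :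
    (G ⧸ V → MeasureAlgebra μ) ≃o (G ⧸ V → MeasureAlgebra μ) where
  toFun A x := σ (cocycle V g (g⁻¹ • x)) (A (g⁻¹ • x))
  invFun A x := (σ (cocycle V g x)).symm (A (g • x))
  left_inv A := by
    ext x
    simp
  right_inv A := by
    ext x
    simp
  map_rel_iff' := by
    intro A B
    refine ⟨fun h x => ?_, fun h x => ?_⟩
    · have := h (g • x)
      simpa using this
    · simpa using h (g⁻¹ • x)

theorem inducedPi_apply (V : Subgroup G) {μ : Measure Ω} (σ : V →* AutStar μ) (g : G)
    (A : G ⧸ V → MeasureAlgebra μ) (x : G ⧸ V) :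
    inducedPi V σ g A x = σ (cocycle V g (g⁻¹ • x)) (A (g⁻¹ • x)) := rfl

theorem inducedPi_mul (V : Subgroup G) {μ : Measure Ω} (σ : V →* AutStar μ) (g h : G)
    (A : G ⧸ V → MeasureAlgebra μ) :
    inducedPi V σ (g * h) A = inducedPi V σ g (inducedPi V σ h A) := by
  ext x
  simp only [inducedPi_apply, mul_inv_rev, mul_smul, cocycle_mul, map_mul, RelIso.mul_apply,
    smul_inv_smul]

/-- The induced action `Ind_V^G(σ)`: `g ({x} × A) = {g x} × (c (g, x) A)`. -/
def induced (V : Subgroup G) {μ : Measure Ω} (σ : V →* AutStar μ) :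
    G →* AutStar (inducedMeasure V μ) :=
  MonoidHom.mk' (fun g =>
      (sigmaEquiv fun _ : G ⧸ V => μ).trans
        ((inducedPi V σ g).trans (sigmaEquiv fun _ : G ⧸ V => μ).symm))
    (by
      intro g h
      ext E
      simp [RelIso.mul_apply, inducedPi_mul])

/-- The element `{x} × A` of the measure algebra of `G ⧸ V × Ω`. -/
def piece (V : Subgroup G) (μ : Measure Ω) (x : G ⧸ V) (A : MeasureAlgebra μ) :
    MeasureAlgebra (inducedMeasure V μ) :=
  open Classical in (sigmaEquiv fun _ : G ⧸ V => μ).symm (fun y => if y = x then A else ⊥)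

theorem piece_mk (V : Subgroup G) (μ : Measure Ω) (x : G ⧸ V) (s : Set Ω)
    (hs : MeasurableSet s) (hm : MeasurableSet (Sigma.mk x '' s : Set (Σ _ : G ⧸ V, Ω))) :
    piece V μ x (MeasureAlgebra.mk μ s hs) =
      MeasureAlgebra.mk (inducedMeasure V μ) (Sigma.mk x '' s) hm := by
  classical
  apply (sigmaEquiv fun _ : G ⧸ V => μ).injective
  ext y
  rw [sigmaEquiv_mk, piece, OrderIso.apply_symm_apply]
  split_ifs with h
  · subst h
    simp only [Set.preimage_image_eq _ sigma_mk_injective]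
  · rw [MeasureAlgebra.bot_eq, MeasureAlgebra.mk_eq_mk, Set.preimage_image_sigmaMk_of_ne h]
    exact EventuallyEq.rfl

theorem induced_piece (V : Subgroup G) {μ : Measure Ω} (σ : V →* AutStar μ) (g : G) (x : G ⧸ V)
    (A : MeasureAlgebra μ) :
    induced V σ g (piece V μ x A) = piece V μ (g • x) (σ (cocycle V g x) A) := by
  classical
  apply (sigmaEquiv fun _ : G ⧸ V => μ).injective
  ext y
  simp only [induced, piece, MonoidHom.mk'_apply, OrderIso.trans_apply,
    OrderIso.apply_symm_apply, inducedPi_apply]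
  by_cases h : y = g • x
  · subst h
    simp
  · have h' : g⁻¹ • y ≠ x := fun e => h (by rw [← e, smul_inv_smul])
    rw [if_neg h, if_neg h', OrderIso.map_bot]

end

end NonsingularActions

end

open NonsingularActions

namespace NonsingularActions

/-! ### Commensurators -/

section Commensurator

variable {G : Type u} [Group G]

/-! The whole argument takes place in the cone of nonnegative functions of `L²(Ω, μ)`, on which `G`
acts through the Koopman representation. The aim is a nonzero vector `ξ` of this cone whose
stabilizer contains an open self-commensurating `V` and which is orthogonal to `gξ` for every `g ∉
V`. For nonnegative functions orthogonality means disjointness of supports, so the translates of the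
support of `ξ` are disjoint pieces indexed by `G ⧸ V`. The measure `|ξ|² μ` is finite and
`V`-invariant, so the action on the union of these pieces is induced from a measure-preserving
action of `V`.

To find `ξ` (`exists_induced_vector`), start from a nonnegative `f₀ ≠ 0`. A small open subgroup
barely moves it, and the point of least norm in the closed convex hull of its orbit under that
subgroup is a nonzero fixed vector `f`. The coefficient `⟪gf, f⟫` depends only on a double coset, so
by Roelcke precompactness it takes finitely many values. These values contain all inner products of
vectors in the weak closure of the orbit `Gf`. Hence there is a nonzero vector of least norm there,
with open stabilizer `W`. If the `W`-orbit of `gW` is infinite and `⟪gξ, ξ⟫ ≠ 0`, a weak limit of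
distinct translates is nonzero, so by minimality it has the same norm, and finiteness of the set of
values forces many of the translates to equal it, a contradiction (`exists_minimal_vector`). The
remaining `g` form the commensurator of `W`, which contains `W` with finite index; summing the
translates over its cosets gives the required vector.

A maximal family of such pieces with disjoint saturations exhausts `Ω` (`exists_exhaustion`): the
complement of the saturations is invariant and would otherwise contain another piece. Gluing the
pieces gives the decomposition, and summing `|gξ|² μ` over all translates gives the invariant
measure. -/

theorem relIndex_conj_eq_ncard_orbit (W K : Subgroup G) (g : G) :
    (ConjAct.toConjAct g • W).relIndex K = (MulAction.orbit K (g : G ⧸ W)).ncard := by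
  rw [← MulAction.index_stabilizer, Subgroup.relIndex]
  congr 1
  ext k
  rw [Subgroup.mem_subgroupOf, MulAction.mem_stabilizer_iff,
    Subgroup.mem_pointwise_smul_iff_inv_smul_mem, ← ConjAct.toConjAct_inv,
    ConjAct.toConjAct_smul, inv_inv]
  change _ ↔ (((k : G) * g : G) : G ⧸ W) = g
  rw [eq_comm, QuotientGroup.eq, mul_assoc]

/-- Both `relIndex` and `ncard` take the value 0 for infinity, and an orbit is never empty, so
nonvanishing is exactly finiteness. -/
theorem relIndex_conj_ne_zero_iff (W K : Subgroup G) (g : G) :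
    (ConjAct.toConjAct g • W).relIndex K ≠ 0 ↔ (MulAction.orbit K (g : G ⧸ W)).Finite := by
  rw [relIndex_conj_eq_ncard_orbit]
  refine ⟨Set.finite_of_ncard_ne_zero, fun h => ?_⟩
  exact (Set.ncard_pos h).2 (MulAction.nonempty_orbit _) |>.ne'

/-- Every coset lies in the `W`-orbit of `aW` for some `a ∈ F`, so there are only finitely many
orbits, and the finite ones have a finite union. -/
theorem finite_setOf_finite_orbit {W : Subgroup G} {F : Set G} (hF : F.Finite)
    (h : (W : Set G) * F * (W : Set G) = Set.univ) :
    {x : G ⧸ W | (MulAction.orbit W x).Finite}.Finite := by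
  have : {x : G ⧸ W | (MulAction.orbit W x).Finite} ⊆
      ⋃ a ∈ {a ∈ F | (MulAction.orbit W (a : G ⧸ W)).Finite}, MulAction.orbit W (a : G ⧸ W) := by
    intro x hx
    obtain ⟨g, rfl⟩ := QuotientGroup.mk_surjective x
    obtain ⟨_, ⟨v, hv, a, ha, rfl⟩, w, hw, rfl⟩ := h.symm ▸ Set.mem_univ g
    have e : ((v * a * w : G) : G ⧸ W) = (⟨v, hv⟩ : W) • (a : G ⧸ W) := by
      rw [QuotientGroup.mk_mul_of_mem _ hw]
      rfl
    have hm : ((v * a * w : G) : G ⧸ W) ∈ MulAction.orbit W (a : G ⧸ W) := e ▸ ⟨_, rfl⟩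
    have hx' : (MulAction.orbit W ((v * a * w : G) : G ⧸ W)).Finite := hx
    rw [MulAction.orbit_eq_iff.2 hm] at hx'
    exact Set.mem_biUnion (show a ∈ {a ∈ F | _} from ⟨ha, hx'⟩) hm
  refine Set.Finite.subset (Set.Finite.biUnion (hF.subset (Set.sep_subset _ _)) ?_) this
  exact fun a ha => ha.2

/-- A finite orbit gives only one half of commensurability. The other half comes from counting: `g`
maps the finite set `S` of cosets with finite orbit into itself, hence onto itself, so `g⁻¹W` also
has a finite orbit. -/
theorem mem_commensurator_of_finite_orbit {W : Subgroup G} {F : Set G} (hF : F.Finite)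
    (h : (W : Set G) * F * (W : Set G) = Set.univ) {g : G}
    (hg : (MulAction.orbit W (g : G ⧸ W)).Finite) :
    g ∈ Subgroup.Commensurable.commensurator W := by
  have hg' := (relIndex_conj_ne_zero_iff W W g).2 hg
  set S := {x : G ⧸ W | (MulAction.orbit W x).Finite} with hS
  have hfin : S.Finite := finite_setOf_finite_orbit hF h
  have hsub : g • S ⊆ S := by
    rintro _ ⟨x, hx, rfl⟩
    obtain ⟨k, rfl⟩ := QuotientGroup.mk_surjective x
    have hk : (MulAction.orbit W (k : G ⧸ W)).Finite := hx
    rw [← relIndex_conj_ne_zero_iff] at hk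
    change (MulAction.orbit W ((g * k : G) : G ⧸ W)).Finite
    rw [← relIndex_conj_ne_zero_iff, map_mul, mul_smul]
    refine Subgroup.relIndex_ne_zero_trans (K := ConjAct.toConjAct g • W) ?_ hg'
    rwa [Subgroup.relIndex_pointwise_smul]
  have heq : g • S = S := Set.eq_of_subset_of_ncard_le hsub
    (by rw [Set.ncard_smul_set]) hfin
  have h1 : ((1 : G) : G ⧸ W) ∈ S := by
    rw [hS, Set.mem_ofPred_eq, ← relIndex_conj_ne_zero_iff]
    simp
  rw [← heq, Set.mem_smul_set_iff_inv_smul_mem] at h1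
  have h2 : (MulAction.orbit W ((g⁻¹ * 1 : G) : G ⧸ W)).Finite := h1
  rw [mul_one, ← relIndex_conj_ne_zero_iff] at h2
  refine ⟨hg', ?_⟩
  rw [← Subgroup.relIndex_pointwise_smul (ConjAct.toConjAct g)] at h2
  simpa using h2

theorem finite_orbit_of_mem_commensurator {W : Subgroup G} {g : G}
    (hg : g ∈ Subgroup.Commensurable.commensurator W) :
    (MulAction.orbit W (g : G ⧸ W)).Finite :=
  (relIndex_conj_ne_zero_iff W W g).1 hg.1

theorem le_commensurator (W : Subgroup G) : W ≤ Subgroup.Commensurable.commensurator W := by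
  intro g hg
  rw [Subgroup.Commensurable.commensurator_mem_iff,
    show ConjAct.toConjAct g • W = W from Subgroup.conj_smul_eq_self_of_mem hg]

/-- The cosets of `W` in its commensurator all have finite orbits, so `W` has finite index there,
and commensurable subgroups have the same commensurator. -/
theorem isSelfCommensurating_commensurator {W : Subgroup G} {F : Set G} (hF : F.Finite)
    (h : (W : Set G) * F * (W : Set G) = Set.univ) :
    IsSelfCommensurating (Subgroup.Commensurable.commensurator W) := by
  have hfin : W.relIndex (Subgroup.Commensurable.commensurator W) ≠ 0 := by
    have := relIndex_conj_ne_zero_iff W (Subgroup.Commensurable.commensurator W) 1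
    rw [map_one, one_smul] at this
    refine this.2 ((finite_setOf_finite_orbit hF h).subset ?_)
    rintro _ ⟨k, rfl⟩
    change (MulAction.orbit W (((k : G) * 1 : G) : G ⧸ W)).Finite
    rw [mul_one]
    exact finite_orbit_of_mem_commensurator k.2
  refine Subgroup.Commensurable.eq (Subgroup.Commensurable.symm ⟨hfin, ?_⟩)
  rw [Subgroup.relIndex_eq_one.2 (le_commensurator W)]
  exact one_ne_zero

end Commensurator

end NonsingularActions

namespace NonsingularActions

/-! ### Isometric representations on real Hilbert spaces -/

section Hilbert

open scoped RealInnerProductSpace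

variable {H : Type v} [NormedAddCommGroup H] [InnerProductSpace ℝ H]

/-- Banach–Alaoglu together with the Riesz representation; an ultrafilter makes subsequences, and
hence separability, unnecessary. -/
theorem exists_weak_limit [CompleteSpace H] {α : Type w} (𝒰 : Ultrafilter α) (u : α → H) (r : ℝ)
    (hu : ∀ a, ‖u a‖ ≤ r) :
    ∃ η : H, ∀ h, Tendsto (fun a => ⟪u a, h⟫) 𝒰 (𝓝 ⟪η, h⟫) := by
  have hc := WeakDual.isCompact_closedBall (𝕜 := ℝ) (E := H) 0 r
  let F : α → WeakDual ℝ H := fun a =>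
    StrongDual.toWeakDual (InnerProductSpace.toDual ℝ H (u a))
  obtain ⟨φ, -, hφ⟩ := hc.ultrafilter_le_nhds (𝒰.map F) (by
    refine le_principal_iff.2 (Filter.mem_map.2 (Filter.Eventually.of_forall fun a => ?_))
    change dist (InnerProductSpace.toDual ℝ H (u a)) 0 ≤ r
    rw [dist_zero_right, LinearIsometryEquiv.norm_map]
    exact hu a)
  refine ⟨(InnerProductSpace.toDual ℝ H).symm (WeakDual.toStrongDual φ), fun h => ?_⟩
  rw [InnerProductSpace.toDual_symm_apply]
  have h1 : Tendsto F 𝒰 (𝓝 φ) := hφ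
  exact ((WeakDual.eval_continuous h).tendsto φ).comp h1

/-- The closure of a set in the weak topology, i.e., the topology of pointwise convergence of
the associated linear functionals. -/
def weakClosure (S : Set H) : Set H :=
  {ξ | (fun h : H => ⟪ξ, h⟫) ∈ closure ((fun (x : H) (h : H) => ⟪x, h⟫) '' S)}

theorem subset_weakClosure (S : Set H) : S ⊆ weakClosure S :=
  fun x hx => subset_closure ⟨x, hx, rfl⟩

theorem weakClosure_induction {S : Set H} {D : Set ℝ} (hD : IsClosed D) (h : H)
    (hS : ∀ x ∈ S, ⟪x, h⟫ ∈ D) {ξ : H} (hξ : ξ ∈ weakClosure S) : ⟪ξ, h⟫ ∈ D := by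
  have hc : IsClosed {φ : H → ℝ | φ h ∈ D} := hD.preimage (continuous_apply h)
  have : (fun (x : H) (h : H) => ⟪x, h⟫) '' S ⊆ {φ : H → ℝ | φ h ∈ D} := by
    rintro _ ⟨x, hx, rfl⟩
    exact hS x hx
  exact (closure_minimal this hc) hξ

/-- The inner product is only separately weakly continuous, so the closure is taken in one variable
at a time. -/
theorem weakClosure_inner_mem {S : Set H} {D : Set ℝ} (hD : IsClosed D)
    (hS : ∀ x ∈ S, ∀ y ∈ S, ⟪x, y⟫ ∈ D) {ξ η : H} (hξ : ξ ∈ weakClosure S)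
    (hη : η ∈ weakClosure S) : ⟪ξ, η⟫ ∈ D := by
  refine weakClosure_induction hD η (fun x hx => ?_) hξ
  rw [real_inner_comm]
  exact weakClosure_induction hD x (fun y hy => hS y hy x hx) hη

/-- Mazur's theorem, by Hahn–Banach separation. It keeps the minimal vector inside the cone. -/
theorem weakClosure_subset_of_convex [CompleteSpace H] {S P : Set H} (hP : Convex ℝ P)
    (hP' : IsClosed P) (hSP : S ⊆ P) : weakClosure S ⊆ P := by
  intro ξ hξ
  by_contra hn
  obtain ⟨φ, r, h1, h2⟩ := geometric_hahn_banach_point_closed hP hP' hn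
  set k := (InnerProductSpace.toDual ℝ H).symm φ
  have hk : ∀ x, φ x = ⟪x, k⟫ := fun x => by
    rw [real_inner_comm, InnerProductSpace.toDual_symm_apply]
  have : ⟪ξ, k⟫ ∈ Ici r := weakClosure_induction isClosed_Ici k
    (fun x hx => by rw [← hk]; exact (h2 x (hSP hx)).le) hξ
  rw [← hk] at this
  exact absurd h1 (not_lt.2 this)

theorem mem_weakClosure_of_tendsto {α : Type w} {l : Filter α} [l.NeBot] {u : α → H} {S : Set H}
    {η : H} (hu : ∀ a, u a ∈ weakClosure S)
    (h : ∀ h, Tendsto (fun a => ⟪u a, h⟫) l (𝓝 ⟪η, h⟫)) : η ∈ weakClosure S := by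
  have : Tendsto (fun a (h : H) => ⟪u a, h⟫) l (𝓝 fun h => ⟪η, h⟫) := tendsto_pi_nhds.2 h
  exact isClosed_closure.mem_of_tendsto this (Eventually.of_forall hu)

/-- The equality case of Cauchy–Schwarz; it turns information on inner products into equalities of
vectors. -/
theorem eq_of_inner_eq_sq {x y : H} (h : ⟪x, y⟫ = ‖x‖ ^ 2) (h' : ‖y‖ = ‖x‖) : x = y := by
  have := norm_sub_sq_real x y
  rw [h, h'] at this
  have h0 : ‖x - y‖ ^ 2 = 0 := by rw [this]; ring
  exact sub_eq_zero.1 (norm_eq_zero.1 (pow_eq_zero_iff two_ne_zero |>.1 h0))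

/-! ### Orbits, stabilizers and matrix coefficients. -/

variable {G : Type u} [Group G] (ρ : G →* (H →ₗᵢ[ℝ] H))

theorem rep_inv_apply_apply (g : G) (x : H) : ρ g⁻¹ (ρ g x) = x := by
  have : (ρ g⁻¹ * ρ g) x = x := by rw [← map_mul, inv_mul_cancel, map_one]; rfl
  exact this

theorem rep_mul_apply (g h : G) (x : H) : ρ (g * h) x = ρ g (ρ h x) := by
  rw [map_mul]; rfl

theorem rep_inner (g : G) (x y : H) : ⟪ρ g x, y⟫ = ⟪x, ρ g⁻¹ y⟫ := by
  rw [← (ρ g).inner_map_map x, ← rep_mul_apply, mul_inv_cancel, map_one]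
  rfl

theorem rep_mem_weakClosure (f : H) (g : G) {ξ : H}
    (hξ : ξ ∈ weakClosure (range fun g => ρ g f)) :
    ρ g ξ ∈ weakClosure (range fun g => ρ g f) := by
  have hc : Continuous fun (φ : H → ℝ) (h : H) => φ (ρ g⁻¹ h) :=
    continuous_pi fun h => continuous_apply _
  have := map_mem_closure hc hξ (t := (fun (x : H) (h : H) => ⟪x, h⟫) '' (range fun g => ρ g f)) (by
    rintro _ ⟨_, ⟨k, rfl⟩, rfl⟩
    refine ⟨_, ⟨g * k, rfl⟩, ?_⟩
    funext h
    simp only [rep_mul_apply, rep_inner ρ g])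
  simpa only [weakClosure, mem_ofPred_eq, rep_inner ρ g] using this

/-- The stabilizer of a vector. -/
def vectorStabilizer (ξ : H) : Subgroup G where
  carrier := {g | ρ g ξ = ξ}
  one_mem' := by simp
  mul_mem' {a b} ha hb := by
    change ρ (a * b) ξ = ξ
    rw [rep_mul_apply, show ρ b ξ = ξ from hb, show ρ a ξ = ξ from ha]
  inv_mem' {a} ha := by
    change ρ a⁻¹ ξ = ξ
    conv_lhs => rw [← show ρ a ξ = ξ from ha]
    exact rep_inv_apply_apply ρ a ξ

theorem mem_vectorStabilizer {ξ : H} {g : G} : g ∈ vectorStabilizer ρ ξ ↔ ρ g ξ = ξ := Iff.rfl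

theorem rep_out_eq {W : Subgroup G} {ξ : H} (hW : ∀ g ∈ W, ρ g ξ = ξ) (g : G) :
    ρ (g : G ⧸ W).out ξ = ρ g ξ := by
  obtain ⟨h, hh⟩ := QuotientGroup.mk_out_eq_mul W g
  rw [hh, rep_mul_apply, hW _ h.2]

/-- The coefficient of a `V`-fixed vector is constant on double cosets of `V`, and `F` meets all of
them. -/
theorem finite_range_inner {V : Subgroup G} {F : Set G} (hF : F.Finite)
    (hV : (V : Set G) * F * (V : Set G) = Set.univ) {f : H} (hf : ∀ g ∈ V, ρ g f = f) :
    (range fun g => ⟪ρ g f, f⟫).Finite := by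
  refine (hF.image fun g => ⟪ρ g f, f⟫).subset ?_
  rintro _ ⟨g, rfl⟩
  obtain ⟨_, ⟨v, hv, a, ha, rfl⟩, w, hw, rfl⟩ := hV.symm ▸ Set.mem_univ g
  refine ⟨a, ha, ?_⟩
  simp only [rep_mul_apply]
  rw [hf w hw, rep_inner ρ v, hf _ (V.inv_mem hv)]

variable [TopologicalSpace G]

theorem exists_fixed_vector [NonarchimedeanGroup G] [CompleteSpace H]
    (hρ : ∀ f, Continuous fun g => ρ g f) {P : Set H}
    (hconv : Convex ℝ P) (hclosed : IsClosed P) (hinv : ∀ g, ∀ f ∈ P, ρ g f ∈ P)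
    {f₀ : H} (h₀ : f₀ ∈ P) (hne : f₀ ≠ 0) :
    ∃ V : Subgroup G, IsOpen (V : Set G) ∧ ∃ f ∈ P, f ≠ 0 ∧ ∀ g ∈ V, ρ g f = f := by
  -- The radius `‖f₀‖ / 2` keeps the closed convex hull of the `V`-orbit away from 0.
  have hU : {g | dist (ρ g f₀) f₀ < ‖f₀‖ / 2} ∈ 𝓝 (1 : G) := by
    refine (isOpen_lt ((hρ f₀).dist continuous_const) continuous_const).mem_nhds ?_
    simp [hne]
  obtain ⟨V, hV⟩ := NonarchimedeanGroup.is_nonarchimedean _ hU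
  set K := closure (convexHull ℝ ((fun g => ρ g f₀) '' (V : Set G))) with hK
  have hKc : Convex ℝ K := (convex_convexHull ℝ _).closure
  have hKP : K ⊆ P := by
    refine closure_minimal (convexHull_min ?_ hconv) hclosed
    rintro _ ⟨g, -, rfl⟩
    exact hinv g _ h₀
  have hKball : K ⊆ Metric.closedBall f₀ (‖f₀‖ / 2) := by
    refine closure_minimal (convexHull_min ?_ (convex_closedBall _ _)) Metric.isClosed_closedBall
    rintro _ ⟨g, hg, rfl⟩
    exact (show dist (ρ g f₀) f₀ < ‖f₀‖ / 2 from hV hg).le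
  have hKne : K.Nonempty := ⟨f₀, subset_closure (subset_convexHull ℝ _ ⟨1, V.one_mem, by simp⟩)⟩
  have hKinv : ∀ g ∈ V, ∀ x ∈ K, ρ g x ∈ K := by
    intro g hg x hx
    refine map_mem_closure (ρ g).continuous hx fun y hy => ?_
    have : (ρ g).toLinearMap '' convexHull ℝ ((fun g => ρ g f₀) '' (V : Set G)) ⊆
        convexHull ℝ ((fun g => ρ g f₀) '' (V : Set G)) := by
      rw [LinearMap.image_convexHull]
      refine convexHull_mono ?_
      rintro _ ⟨_, ⟨k, hk, rfl⟩, rfl⟩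
      exact ⟨g * k, V.mul_mem hg hk, rep_mul_apply ρ g k f₀⟩
    exact this ⟨y, hy, rfl⟩
  obtain ⟨f, hfK, hf⟩ := exists_norm_eq_iInf_of_complete_convex hKne isClosed_closure.isComplete
    hKc 0
  have hmin := (norm_eq_iInf_iff_real_inner_le_zero hKc hfK).1 hf
  refine ⟨V, V.isOpen, f, hKP hfK, ?_, fun g hg => ?_⟩
  · rintro rfl
    have := hKball hfK
    rw [Metric.mem_closedBall, dist_zero_left] at this
    linarith [norm_pos_iff.2 hne]
  -- Minimality of the norm, tested at `ρ g f`, gives `‖f‖² ≤ ⟪f, ρ g f⟫`, so Cauchy–Schwarz is an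
  -- equality.
  · have := hmin _ (hKinv g hg f hfK)
    rw [zero_sub, inner_neg_left, inner_sub_right, real_inner_self_eq_norm_sq] at this
    have h2 := real_inner_le_norm f (ρ g f)
    rw [(ρ g).norm_map] at h2
    exact (eq_of_inner_eq_sq (by nlinarith) ((ρ g).norm_map f)).symm

/-- In the weak closure of the orbit of a vector whose orbit has finitely many inner products
there is a nonzero vector with open stabilizer whose translates are orthogonal to it, unless they
have finite orbits under the stabilizer. -/
theorem exists_minimal_vector [CompleteSpace H] (hρ : ∀ f, Continuous fun g => ρ g f)
    {f : H} (hne : f ≠ 0) (hD : (range fun g => ⟪ρ g f, f⟫).Finite) :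
    ∃ ξ ∈ weakClosure (range fun g => ρ g f), ξ ≠ 0 ∧
      IsOpen (vectorStabilizer ρ ξ : Set G) ∧
      ∀ g : G, ¬ (MulAction.orbit (vectorStabilizer ρ ξ)
        (g : G ⧸ vectorStabilizer ρ ξ)).Finite → ⟪ρ g ξ, ξ⟫ = 0 := by
  set C := weakClosure (range fun g => ρ g f) with hC
  set D := range fun g => ⟪ρ g f, f⟫ with hDdef
  have hfC : f ∈ C := subset_weakClosure _ ⟨1, by simp⟩
  have hinner : ∀ {ξ η}, ξ ∈ C → η ∈ C → ⟪ξ, η⟫ ∈ D := fun hξ hη =>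
    weakClosure_inner_mem hD.isClosed (by
      rintro _ ⟨a, rfl⟩ _ ⟨b, rfl⟩
      refine ⟨b⁻¹ * a, ?_⟩
      simp only [rep_mul_apply]
      rw [rep_inner ρ b⁻¹, inv_inv]) hξ hη
  -- The squared norms of vectors in `C` lie in the finite set `D`, so a least nonzero one exists.
  have hfin : ((fun ξ : H => ⟪ξ, ξ⟫) '' {ξ ∈ C | ξ ≠ 0}).Finite := hD.subset (by
    rintro _ ⟨ξ, hξ, rfl⟩
    exact hinner hξ.1 hξ.1)
  obtain ⟨m, ⟨ξ, ⟨hξC, hξ0⟩, rfl⟩, hmin⟩ := Set.exists_min_image _ id hfin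
    ⟨_, f, ⟨hfC, hne⟩, rfl⟩
  have hmin' : ∀ η ∈ C, η ≠ 0 → ‖ξ‖ ≤ ‖η‖ := fun η hη h0 => by
    have := hmin _ ⟨η, ⟨hη, h0⟩, rfl⟩
    simp only [id, real_inner_self_eq_norm_sq] at this
    exact le_of_sq_le_sq this (norm_nonneg _)
  refine ⟨ξ, hξC, hξ0, ?_, fun g hg => ?_⟩
  -- Stabilizing `ξ` means that the coefficient equals `⟪ξ, ξ⟫`. Since it only takes values in the
  -- finite set `D`, this is an open condition.
  · have h1 : (vectorStabilizer ρ ξ : Set G) = (fun g => ⟪ρ g ξ, ξ⟫) ⁻¹' (D \ {⟪ξ, ξ⟫})ᶜ := by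
      ext g
      simp only [SetLike.mem_coe, mem_vectorStabilizer, mem_preimage, mem_compl_iff, Set.mem_sdiff,
        hinner (rep_mem_weakClosure ρ f g hξC) hξC, true_and, mem_singleton_iff, not_not]
      refine ⟨fun h => by rw [h], fun h => eq_of_inner_eq_sq ?_ ((ρ g).norm_map ξ).symm⟩
      rw [h, real_inner_self_eq_norm_sq, (ρ g).norm_map]
    rw [h1]
    exact (hD.subset Set.sdiff_subset).isClosed.isOpen_compl.preimage
      ((hρ ξ).inner continuous_const)
  · by_contra hne'
    set W := vectorStabilizer ρ ξ
    have : Infinite (MulAction.orbit W (g : G ⧸ W)) := Set.infinite_coe_iff.2 hg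
    let u : MulAction.orbit W (g : G ⧸ W) → H := fun x => ρ x.1.out ξ
    have hW : ∀ g ∈ W, ρ g ξ = ξ := fun g hg => hg
    have huC : ∀ x, u x ∈ C := fun x => rep_mem_weakClosure ρ f _ hξC
    have hun : ∀ x, ‖u x‖ = ‖ξ‖ := fun x => (ρ _).norm_map ξ
    -- A weak limit along a nonprincipal ultrafilter on the infinite orbit; pairing with `ξ` is
    -- constant along the orbit, so the limit inherits `⟪η, ξ⟫ = ⟪ρ g ξ, ξ⟫ ≠ 0`.
    obtain ⟨η, hη⟩ := exists_weak_limit (hyperfilter (MulAction.orbit W (g : G ⧸ W))) u ‖ξ‖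
      fun x => (hun x).le
    have hηC : η ∈ C := mem_weakClosure_of_tendsto huC hη
    have hu : ∀ x, ⟪u x, ξ⟫ = ⟪ρ g ξ, ξ⟫ := by
      rintro ⟨_, w, rfl⟩
      have : u ⟨w • (g : G ⧸ W), w, rfl⟩ = ρ (w * g : G) ξ := rep_out_eq ρ hW (w * g : G)
      rw [this, rep_mul_apply, rep_inner ρ (w : G), hW _ (W.inv_mem w.2)]
    have h1 : ⟪η, ξ⟫ = ⟪ρ g ξ, ξ⟫ := by
      have := hη ξ
      simp only [hu] at this
      exact tendsto_nhds_unique this tendsto_const_nhds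
    have hη0 : η ≠ 0 := by
      rintro rfl
      rw [inner_zero_left] at h1
      exact hne' h1.symm
    have hle : ‖η‖ ≤ ‖ξ‖ := by
      have h2 : ⟪η, η⟫ ≤ ‖ξ‖ * ‖η‖ := le_of_tendsto (hη η) (Eventually.of_forall fun x => by
        rw [← hun x]
        exact real_inner_le_norm _ _)
      rw [real_inner_self_eq_norm_mul_norm] at h2
      exact le_of_mul_le_mul_right h2 (norm_pos_iff.2 hη0)
    have hηξ : ‖η‖ = ‖ξ‖ := hle.antisymm (hmin' η hηC hη0)
    -- A convergent family with values in the finite set `D` eventually equals its limit.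
    have hev : ∀ᶠ x in (hyperfilter (MulAction.orbit W (g : G ⧸ W)) : Filter _),
        ⟪u x, η⟫ = ⟪η, η⟫ := by
      have hopen : (D \ {⟪η, η⟫})ᶜ ∈ 𝓝 ⟪η, η⟫ :=
        (hD.subset Set.sdiff_subset).isClosed.isOpen_compl.mem_nhds fun h => h.2 rfl
      filter_upwards [hη η hopen] with x hx
      by_contra hxn
      exact hx ⟨hinner (huC x) hηC, hxn⟩
    have hev2 : ∀ᶠ x in (hyperfilter (MulAction.orbit W (g : G ⧸ W)) : Filter _), u x = η := by
      filter_upwards [hev] with x hx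
      refine eq_of_inner_eq_sq ?_ (by rw [hun, hηξ])
      rw [hx, real_inner_self_eq_norm_sq, hηξ, hun]
    obtain ⟨x₀, hx₀⟩ := hev2.exists
    -- Distinct cosets of the full stabilizer give distinct translates, so `u` can take the value
    -- `η` at only one point.
    have hinj : ∀ x y, u x = u y → x = y := by
      intro x y hxy
      have : x.1.out⁻¹ * y.1.out ∈ W := by
        change ρ _ ξ = ξ
        rw [rep_mul_apply]
        change ρ _ (u y) = ξ
        rw [← hxy]
        exact rep_inv_apply_apply ρ _ ξ
      rw [← QuotientGroup.eq, QuotientGroup.out_eq', QuotientGroup.out_eq'] at this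
      exact Subtype.ext this
    have hno : ∀ᶠ x in (hyperfilter (MulAction.orbit W (g : G ⧸ W)) : Filter _), x ≠ x₀ :=
      hyperfilter_le_cofinite (Set.finite_singleton x₀).compl_mem_cofinite
    obtain ⟨x, hx, hxne⟩ := (hev2.and hno).exists
    exact hxne (hinj x x₀ (hx.trans hx₀.symm))

/-- In a closed convex invariant cone of vectors with nonnegative inner products, there is
a nonzero vector whose stabilizer is open and self-commensurating, and which is orthogonal to its
other translates. -/
theorem exists_induced_vector [NonarchimedeanGroup G] (hG : IsRoelckePrecompact G)
    [CompleteSpace H] (hρ : ∀ f, Continuous fun g => ρ g f) {P : Set H}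
    (hconv : Convex ℝ P) (hclosed : IsClosed P) (hinv : ∀ g, ∀ f ∈ P, ρ g f ∈ P)
    (hzero : 0 ∈ P) (hadd : ∀ a ∈ P, ∀ b ∈ P, a + b ∈ P) (hpos : ∀ a ∈ P, ∀ b ∈ P, 0 ≤ ⟪a, b⟫)
    {f₀ : H} (h₀ : f₀ ∈ P) (hne : f₀ ≠ 0) :
    ∃ ξ ∈ P, ξ ≠ 0 ∧ ∃ V : Subgroup G, IsOpen (V : Set G) ∧ IsSelfCommensurating V ∧
      (∀ g ∈ V, ρ g ξ = ξ) ∧ ∀ g ∉ V, ⟪ρ g ξ, ξ⟫ = 0 := by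
  classical
  obtain ⟨V, hVo, f, hfP, hf0, hfV⟩ := exists_fixed_vector ρ hρ hconv hclosed hinv h₀ hne
  obtain ⟨F, hF, hVF⟩ := hG V (hVo.mem_nhds V.one_mem)
  obtain ⟨ξ, hξC, hξ0, hWo, hξ⟩ := exists_minimal_vector ρ hρ hf0 (finite_range_inner ρ hF hVF hfV)
  have hξP : ξ ∈ P := weakClosure_subset_of_convex hconv hclosed
    (by rintro _ ⟨g, rfl⟩; exact hinv g f hfP) hξC
  set W := vectorStabilizer ρ ξ
  have hW : ∀ g ∈ W, ρ g ξ = ξ := fun g hg => hg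
  obtain ⟨F', hF', hWF⟩ := hG W (hWo.mem_nhds W.one_mem)
  set K := Subgroup.Commensurable.commensurator W with hK
  have horth : ∀ g ∉ K, ⟪ρ g ξ, ξ⟫ = 0 := fun g hg =>
    hξ g fun h => hg (mem_commensurator_of_finite_orbit hF' hWF h)
  have hKmem : ∀ g : G, (MulAction.orbit W (g : G ⧸ W)).Finite ↔ g ∈ K := fun g =>
    ⟨mem_commensurator_of_finite_orbit hF' hWF, finite_orbit_of_mem_commensurator⟩
  have hS := finite_setOf_finite_orbit hF' hWF
  set S : Finset (G ⧸ W) := hS.toFinset with hSdef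
  have hSK : ∀ x : G ⧸ W, x ∈ S ↔ x.out ∈ K := fun x => by
    rw [hSdef, Set.Finite.mem_toFinset, ← hKmem, QuotientGroup.out_eq']
    rfl
  have hSK' : ∀ g : G, (g : G ⧸ W) ∈ S ↔ g ∈ K := fun g => by
    rw [hSdef, Set.Finite.mem_toFinset, ← hKmem]
    rfl
  have hmem : ∀ x : G ⧸ W, ρ x.out ξ ∈ P := fun x => hinv _ _ hξP
  have hsum : ∀ T : Finset (G ⧸ W), ∑ x ∈ T, ρ x.out ξ ∈ P := fun T => by
    induction T using Finset.induction_on with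
    | empty => simpa using hzero
    | insert a T ha ih =>
      rw [Finset.sum_insert ha]
      exact hadd _ (hmem a) _ ih
  have h1S : ((1 : G) : G ⧸ W) ∈ S := (hSK' 1).2 K.one_mem
  -- `S` is the image of `K` in `G ⧸ W`, so this is the sum of the translates of `ξ` over `K/W`.
  refine ⟨∑ x ∈ S, ρ x.out ξ, hsum S, ?_, K, ?_, ?_, ?_, ?_⟩
  · intro h
    -- No cancellation can occur: all terms are nonnegative, and the one at the trivial coset is
    -- `‖ξ‖²`.
    have h1 : ⟪ρ ((1 : G) : G ⧸ W).out ξ, ∑ x ∈ S, ρ x.out ξ⟫ = 0 := by rw [h, inner_zero_right]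
    rw [inner_sum, Finset.sum_eq_zero_iff_of_nonneg fun x _ => hpos _ (hmem _) _ (hmem _)] at h1
    have := h1 _ h1S
    rw [inner_self_eq_zero, rep_out_eq ρ hW, map_one] at this
    exact hξ0 this
  · exact Subgroup.isOpen_mono (le_commensurator W) hWo
  · exact isSelfCommensurating_commensurator hF' hWF
  · intro g hg
    rw [map_sum]
    have e : ∀ x : G ⧸ W, ρ g (ρ x.out ξ) = ρ (g • x).out ξ := fun x => by
      rw [← rep_mul_apply, ← rep_out_eq ρ hW (g * x.out)]
      congr 3
      conv_rhs => rw [← QuotientGroup.out_eq' x]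
      rfl
    simp only [e]
    refine Finset.sum_bijective (fun x => g • x) (MulAction.bijective g) (fun x => ?_) fun _ _ => rfl
    obtain ⟨k, rfl⟩ := QuotientGroup.mk_surjective x
    change _ ↔ ((g * k : G) : G ⧸ W) ∈ S
    rw [hSK', hSK', Subgroup.mul_mem_cancel_left _ hg]
  · intro g hg
    rw [map_sum, sum_inner]
    refine Finset.sum_eq_zero fun x hx => ?_
    rw [inner_sum]
    refine Finset.sum_eq_zero fun y hy => ?_
    rw [hSK] at hx hy
    -- The term is the coefficient of `ξ` at `y⁻¹ g x`, which lies outside of `K` because `x, y ∈ K`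
    -- and `g ∉ K`.
    rw [← inv_inv y.out, ← rep_inner ρ, ← rep_mul_apply, ← rep_mul_apply]
    refine horth _ fun h => hg ?_
    rw [Subgroup.mul_mem_cancel_right _ hx, Subgroup.mul_mem_cancel_left _ (K.inv_mem hy)] at h
    exact h

end Hilbert

end NonsingularActions

namespace NonsingularActions

/-! ### The Koopman representation -/

namespace AutStar

open MeasureAlgebra
open scoped ComplexOrder

/-! ### Functional calculus for the transport of functions. -/

section Transport

variable {Ω : Type v} [MeasurableSpace Ω] {μ : Measure Ω} (g : AutStar μ)

theorem transport_congr {f f' : Ω → ℂ} (hf : Measurable f) (hf' : Measurable f')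
    (h : f =ᵐ[μ] f') : transport g f hf =ᵐ[μ] transport g f' hf' := by
  refine transport_unique g f' hf' _ (measurable_transport g f hf) fun B hB => ?_
  rw [transport_spec g f hf hB]
  congr 1
  rw [mk_eq_mk]
  exact h.fun_comp (· ∈ B)

theorem transport_comp {f : Ω → ℂ} (hf : Measurable f) {ψ : ℂ → ℂ} (hψ : Measurable ψ) :
    (fun x => ψ (transport g f hf x)) =ᵐ[μ] transport g (fun x => ψ (f x)) (hψ.comp hf) :=
  transport_unique g _ _ _ (hψ.comp (measurable_transport g f hf)) fun _ hB =>
    transport_spec g f hf (hψ hB)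

/-- A Borel isomorphism of `ℂ × ℂ` with `ℂ` codes the pair as a single function `F`, of which `f₁`,
`f₂` and the combined function are all Borel images; the one-variable statement then applies. -/
theorem transport_comp₂ {f₁ f₂ : Ω → ℂ} (h₁ : Measurable f₁) (h₂ : Measurable f₂)
    {φ : ℂ × ℂ → ℂ} (hφ : Measurable φ) (h : Measurable fun x => φ (f₁ x, f₂ x)) :
    transport g (fun x => φ (f₁ x, f₂ x)) h =ᵐ[μ]
      fun x => φ (transport g f₁ h₁ x, transport g f₂ h₂ x) := by
  have hC : ¬ Countable ℂ := fun h => not_countable_complex (Set.countable_univ_iff.2 h)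
  have hC2 : ¬ Countable (ℂ × ℂ) := fun h =>
    hC (Function.Injective.countable (f := fun z : ℂ => (z, z)) fun _ _ h => congrArg Prod.fst h)
  let e : ℂ × ℂ ≃ᵐ ℂ := PolishSpace.measurableEquivOfNotCountable hC2 hC
  let F : Ω → ℂ := fun x => e (f₁ x, f₂ x)
  have hF : Measurable F := e.measurable.comp (h₁.prodMk h₂)
  have key : ∀ (φ : ℂ × ℂ → ℂ) (f : Ω → ℂ) (hf : Measurable f) (_ : Measurable φ)
      (_ : ∀ x, f x = φ (f₁ x, f₂ x)),
      transport g f hf =ᵐ[μ] fun x => φ (e.symm (transport g F hF x)) := by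
    intro φ f hf hφ hff
    refine EventuallyEq.trans ?_ (transport_comp g hF (hφ.comp e.symm.measurable)).symm
    refine transport_congr g _ _ (Eventually.of_forall fun x => ?_)
    simp [F, hff]
  filter_upwards [key φ _ h hφ fun x => rfl, key Prod.fst f₁ h₁ measurable_fst fun x => rfl,
    key Prod.snd f₂ h₂ measurable_snd fun x => rfl] with x h1 h2 h3
  rw [h1, h2, h3]

theorem transport_mem {f : Ω → ℂ} (hf : Measurable f) {B : Set ℂ} (hB : MeasurableSet B)
    (h : ∀ᵐ x ∂μ, f x ∈ B) : ∀ᵐ x ∂μ, transport g f hf x ∈ B := by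
  have h1 := transport_spec g f hf hB
  have h2 : mk μ (f ⁻¹' B) (hf hB) = ⊤ := by
    rw [top_eq, mk_eq_mk]
    exact eventuallyEq_univ.2 h
  rw [h2, OrderIso.map_top, top_eq, mk_eq_mk] at h1
  exact eventuallyEq_univ.1 h1

theorem transport_indicator {f : Ω → ℂ} (hf : Measurable f) {s t : Set Ω} (hs : MeasurableSet s)
    (ht : MeasurableSet t) (hst : mk μ t ht = g (mk μ s hs)) (hfs : Measurable (s.indicator f)) :
    transport g (s.indicator f) hfs =ᵐ[μ] t.indicator (transport g f hf) := by
  have h1 : Measurable (s.indicator fun _ => (1 : ℂ)) := measurable_const.indicator hs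
  have h2 : Measurable (t.indicator fun _ => (1 : ℂ)) := measurable_const.indicator ht
  have h3 : (t.indicator fun _ => (1 : ℂ)) =ᵐ[μ] transport g (s.indicator fun _ => (1 : ℂ)) h1 := by
    refine transport_unique g _ _ _ h2 fun B hB => ?_
    classical
    by_cases hB1 : (1 : ℂ) ∈ B <;> by_cases hB0 : (0 : ℂ) ∈ B
    · have : ∀ r : Set Ω, (r.indicator fun _ => (1 : ℂ)) ⁻¹' B = Set.univ := fun r => by
        ext x; by_cases hx : x ∈ r <;> simp [hx, hB1, hB0]
      simp only [this]
      exact (OrderIso.map_top g).symm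
    · have : ∀ r : Set Ω, (r.indicator fun _ => (1 : ℂ)) ⁻¹' B = r := fun r => by
        ext x; by_cases hx : x ∈ r <;> simp [hx, hB1, hB0]
      simp only [this]
      exact hst
    · have : ∀ r : Set Ω, (r.indicator fun _ => (1 : ℂ)) ⁻¹' B = rᶜ := fun r => by
        ext x; by_cases hx : x ∈ r <;> simp [hx, hB1, hB0]
      simp only [this, ← compl_mk hs, ← compl_mk ht, hst, map_compl']
    · have : ∀ r : Set Ω, (r.indicator fun _ => (1 : ℂ)) ⁻¹' B = ∅ := fun r => by
        ext x; by_cases hx : x ∈ r <;> simp [hx, hB1, hB0]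
      simp only [this]
      exact (OrderIso.map_bot g).symm
  have h4 := transport_comp₂ g h1 hf (φ := fun p => p.1 * p.2) measurable_mul (h1.mul hf)
  have h5 := transport_congr g hfs (h1.mul hf) (Eventually.of_forall fun x => by
    by_cases hx : x ∈ s <;> simp [hx])
  filter_upwards [h3, h4, h5] with x h3 h4 h5
  rw [h5]
  refine h4.trans ?_
  simp only [← h3]
  by_cases hx : x ∈ t <;> simp [hx]

theorem transport_mul_apply (h : AutStar μ) {f : Ω → ℂ} (hf : Measurable f) :
    transport (g * h) f hf =ᵐ[μ]
      transport g (transport h f hf) (measurable_transport h f hf) := by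
  refine (transport_unique _ _ _ _ (measurable_transport g _ _) fun B hB => ?_).symm
  rw [transport_spec g _ _ hB, transport_spec h f hf hB]
  rfl

theorem transport_one_apply {f : Ω → ℂ} (hf : Measurable f) :
    transport (1 : AutStar μ) f hf =ᵐ[μ] f :=
  (transport_unique _ _ _ _ hf fun _ _ => rfl).symm

theorem push_absolutelyContinuous : push g ≪ μ := by
  refine Measure.AbsolutelyContinuous.mk fun s hs h => ?_
  have : mk μ s hs = ⊥ := by rw [bot_eq, mk_eq_mk]; exact ae_eq_empty.2 h
  rw [push_apply g hs, this, OrderIso.map_bot, bot_eq, value_mk, measure_empty]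

theorem push_of_mk_eq {s t : Set Ω} (hs : MeasurableSet s) (ht : MeasurableSet t)
    (hst : mk μ t ht = g (mk μ s hs)) : push g t = μ s := by
  rw [push_apply g ht, hst, OrderIso.symm_apply_apply, value_mk]

instance sigmaFinite_push [SigmaFinite μ] : SigmaFinite (push g) := by
  choose t ht hts using fun n => exists_rep (g (mk μ (spanningSets μ n) (measurableSet_spanningSets μ n)))
  have h1 : mk μ (⋃ n, t n) (MeasurableSet.iUnion ht) = ⊤ := by
    have a1 := isLUB_iUnion (μ := μ) (spanningSets μ) (measurableSet_spanningSets μ)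
    have a2 := (OrderIso.isLUB_image' g).2 a1
    rw [← Set.range_comp] at a2
    simp only [Function.comp_def, ← hts] at a2
    rw [(isLUB_iUnion t ht).unique a2, ← OrderIso.map_top g, top_eq]
    simp only [iUnion_spanningSets]
  rw [top_eq, mk_eq_mk] at h1
  have h2 : push g (⋃ n, t n)ᶜ = 0 := by
    apply push_absolutelyContinuous g
    rw [← ae_eq_empty]
    simpa using h1.compl
  -- The representatives `t n` cover only almost everywhere, so the null remainder is added to each
  -- of them.
  refine ⟨⟨⟨fun n => t n ∪ (⋃ n, t n)ᶜ, fun _ => trivial, fun n => ?_, ?_⟩⟩⟩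
  · refine (measure_union_le _ _).trans_lt ?_
    rw [h2, add_zero, push_of_mk_eq g (measurableSet_spanningSets μ n) (ht n) (hts n)]
    exact measure_spanningSets_lt_top μ n
  · rw [← iUnion_union, union_compl_self]

end Transport

/-! ### The Koopman formula on measurable functions. -/

section KoopmanFun

variable {Ω : Type v} [MeasurableSpace Ω] {μ : Measure Ω} (g : AutStar μ)

theorem measurable_koopmanFun {f : Ω → ℂ} (hf : Measurable f) :
    Measurable (koopmanFun g f hf) := by
  have := measurable_transport g f hf
  have := (push g).measurable_rnDeriv μ
  unfold koopmanFun
  fun_prop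

theorem koopmanFun_congr {f f' : Ω → ℂ} (hf : Measurable f) (hf' : Measurable f')
    (h : f =ᵐ[μ] f') : koopmanFun g f hf =ᵐ[μ] koopmanFun g f' hf' := by
  filter_upwards [transport_congr g hf hf' h] with x hx
  simp only [koopmanFun, hx]

theorem koopmanFun_add {f f' : Ω → ℂ} (hf : Measurable f) (hf' : Measurable f')
    (h : Measurable fun x => f x + f' x) :
    koopmanFun g (fun x => f x + f' x) h =ᵐ[μ]
      fun x => koopmanFun g f hf x + koopmanFun g f' hf' x := by
  filter_upwards [transport_comp₂ g hf hf' (φ := fun p => p.1 + p.2) measurable_add h] with x hx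
  simp only [koopmanFun, hx, mul_add]

theorem koopmanFun_mul {f f' : Ω → ℂ} (hf : Measurable f) (hf' : Measurable f')
    (h : Measurable fun x => f x * f' x) :
    koopmanFun g (fun x => f x * f' x) h =ᵐ[μ]
      fun x => transport g f hf x * koopmanFun g f' hf' x := by
  filter_upwards [transport_comp₂ g hf hf' (φ := fun p => p.1 * p.2) measurable_mul h] with x hx
  simp only [koopmanFun, hx]
  ring

theorem koopmanFun_const_mul (c : ℂ) {f : Ω → ℂ} (hf : Measurable f)
    (h : Measurable fun x => c * f x) :
    koopmanFun g (fun x => c * f x) h =ᵐ[μ] fun x => c * koopmanFun g f hf x := by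
  filter_upwards [transport_comp g hf (ψ := fun z => c * z) (measurable_const_mul c)] with x hx
  simp only [koopmanFun, ← hx]
  ring

theorem koopmanFun_nonneg {f : Ω → ℂ} (hf : Measurable f) (h : ∀ᵐ x ∂μ, 0 ≤ f x) :
    ∀ᵐ x ∂μ, 0 ≤ koopmanFun g f hf x := by
  filter_upwards [transport_mem g hf (B := Ici 0) isClosed_Ici.measurableSet h] with x hx
  exact mul_nonneg (Complex.zero_le_real.2 (Real.sqrt_nonneg _)) hx

theorem koopmanFun_indicator {f : Ω → ℂ} (hf : Measurable f) {s t : Set Ω} (hs : MeasurableSet s)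
    (ht : MeasurableSet t) (hst : mk μ t ht = g (mk μ s hs)) (hfs : Measurable (s.indicator f)) :
    koopmanFun g (s.indicator f) hfs =ᵐ[μ] t.indicator (koopmanFun g f hf) := by
  filter_upwards [transport_indicator g hf hs ht hst hfs] with x hx
  by_cases h : x ∈ t <;> simp [koopmanFun, hx, h]

variable [SigmaFinite μ]

theorem lintegral_koopmanFun {f : Ω → ℂ} (hf : Measurable f) :
    ∫⁻ x, ‖koopmanFun g f hf x‖ₑ ^ (2 : ℝ) ∂μ = ∫⁻ x, ‖f x‖ₑ ^ (2 : ℝ) ∂μ := by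
  have hm := measurable_transport g f hf
  have hn : Measurable fun z : ℂ => ‖z‖ₑ ^ (2 : ℝ) := by fun_prop
  calc ∫⁻ x, ‖koopmanFun g f hf x‖ₑ ^ (2 : ℝ) ∂μ
      = ∫⁻ x, (push g).rnDeriv μ x * ‖transport g f hf x‖ₑ ^ (2 : ℝ) ∂μ := by
        refine lintegral_congr_ae ?_
        filter_upwards [(push g).rnDeriv_lt_top μ] with x hx
        simp only [koopmanFun, enorm_mul]
        rw [ENNReal.mul_rpow_of_nonneg _ _ zero_le_two, ← ofReal_norm, Complex.norm_real,
          Real.norm_of_nonneg (Real.sqrt_nonneg _),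
          ENNReal.ofReal_rpow_of_nonneg (Real.sqrt_nonneg _) zero_le_two, Real.rpow_two,
          Real.sq_sqrt ENNReal.toReal_nonneg, ENNReal.ofReal_toReal hx.ne]
    _ = ∫⁻ x, ‖transport g f hf x‖ₑ ^ (2 : ℝ) ∂(push g) :=
        lintegral_rnDeriv_mul (push_absolutelyContinuous g) (hn.comp hm).aemeasurable
    _ = ∫⁻ x, ‖f x‖ₑ ^ (2 : ℝ) ∂μ := by
        rw [← lintegral_map hn hm, map_transport, lintegral_map hn hf]

/-- The global identity applied to the indicator of `s` times `f`. Every measurable `t` arises here,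
so this determines the modulus of `koopmanFun g f`. -/
theorem setLIntegral_koopmanFun {f : Ω → ℂ} (hf : Measurable f) {s t : Set Ω}
    (hs : MeasurableSet s) (ht : MeasurableSet t) (hst : mk μ t ht = g (mk μ s hs)) :
    ∫⁻ x in t, ‖koopmanFun g f hf x‖ₑ ^ (2 : ℝ) ∂μ = ∫⁻ x in s, ‖f x‖ₑ ^ (2 : ℝ) ∂μ := by
  have hi : ∀ (r : Set Ω) (f : Ω → ℂ) (x : Ω),
      r.indicator (fun x => ‖f x‖ₑ ^ (2 : ℝ)) x = ‖r.indicator f x‖ₑ ^ (2 : ℝ) := by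
    intro r f x
    by_cases h : x ∈ r <;> simp [h]
  rw [← lintegral_indicator ht, ← lintegral_indicator hs]
  simp only [hi]
  rw [← lintegral_koopmanFun g (hf.indicator hs)]
  refine lintegral_congr_ae ?_
  filter_upwards [koopmanFun_indicator g hf hs ht hst (hf.indicator hs)] with x hx
  rw [hx]

theorem ae_eq_of_setLIntegral_eq {a b : Ω → ℂ} (ha : Measurable a) (hb : Measurable b)
    (ha0 : ∀ᵐ x ∂μ, 0 ≤ a x) (hb0 : ∀ᵐ x ∂μ, 0 ≤ b x)
    (h : ∀ s, MeasurableSet s →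
      ∫⁻ x in s, ‖a x‖ₑ ^ (2 : ℝ) ∂μ = ∫⁻ x in s, ‖b x‖ₑ ^ (2 : ℝ) ∂μ) : a =ᵐ[μ] b := by
  have := ae_eq_of_forall_setLIntegral_eq_of_sigmaFinite (μ := μ)
    (f := fun x => ‖a x‖ₑ ^ (2 : ℝ)) (g := fun x => ‖b x‖ₑ ^ (2 : ℝ)) (by fun_prop) (by fun_prop)
    fun s hs _ => h s hs
  filter_upwards [this, ha0, hb0] with x hx h1 h2
  have h3 : ‖a x‖ₑ = ‖b x‖ₑ := (ENNReal.rpow_left_injective two_ne_zero) hx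
  have h4 : ‖a x‖ = ‖b x‖ := by simpa using congrArg ENNReal.toReal h3
  rw [Complex.eq_coe_norm_of_nonneg h1, Complex.eq_coe_norm_of_nonneg h2, h4]

/-- The chain rule for Radon–Nikodym derivatives. For `f = 1` both sides are nonnegative with the
same integrals of squares over all sets; the general case follows by factoring out the transport of
`f`. Since 1 need not be square-integrable, this is done for functions and not in `L²`. -/
theorem koopmanFun_mul_apply (h : AutStar μ) {f : Ω → ℂ} (hf : Measurable f) :
    koopmanFun (g * h) f hf =ᵐ[μ]
      koopmanFun g (koopmanFun h f hf) (measurable_koopmanFun h hf) := by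
  have h1 : Measurable fun _ : Ω => (1 : ℂ) := measurable_const
  have hpos : ∀ k : AutStar μ, ∀ᵐ x ∂μ, 0 ≤ koopmanFun k (fun _ => 1) h1 x := fun k =>
    koopmanFun_nonneg k h1 (Eventually.of_forall fun _ => zero_le_one)
  have e : koopmanFun (g * h) (fun _ => 1) h1 =ᵐ[μ]
      koopmanFun g (koopmanFun h (fun _ => 1) h1) (measurable_koopmanFun h h1) := by
    refine ae_eq_of_setLIntegral_eq (measurable_koopmanFun _ _) (measurable_koopmanFun _ _)
      (hpos _) (koopmanFun_nonneg g _ (hpos h)) fun s hs => ?_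
    obtain ⟨t, ht, hts⟩ := exists_rep (g.symm (mk μ s hs))
    obtain ⟨r, hr, hrt⟩ := exists_rep (h.symm (mk μ t ht))
    have a1 : mk μ s hs = g (mk μ t ht) := by rw [hts, OrderIso.apply_symm_apply]
    have a2 : mk μ t ht = h (mk μ r hr) := by rw [hrt, OrderIso.apply_symm_apply]
    rw [setLIntegral_koopmanFun g _ ht hs a1, setLIntegral_koopmanFun h _ hr ht a2,
      setLIntegral_koopmanFun (g * h) _ hr hs (by rw [a1, a2]; rfl)]
  have e1 : ∀ (k : AutStar μ) (f : Ω → ℂ) (hf : Measurable f), koopmanFun k f hf =ᵐ[μ]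
      fun x => transport k f hf x * koopmanFun k (fun _ => 1) h1 x := by
    intro k f hf
    refine EventuallyEq.trans ?_ (koopmanFun_mul k hf h1 (hf.mul h1))
    exact koopmanFun_congr k _ _ (Eventually.of_forall fun x => (mul_one _).symm)
  have e2 : koopmanFun g (koopmanFun h f hf) (measurable_koopmanFun h hf) =ᵐ[μ]
      fun x => transport g _ (measurable_transport h f hf) x *
        koopmanFun g _ (measurable_koopmanFun h h1) x :=
    (koopmanFun_congr g _ ((measurable_transport h f hf).mul (measurable_koopmanFun h h1))
      (e1 h f hf)).trans (koopmanFun_mul g _ _ _)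
  filter_upwards [e, e1 (g * h) f hf, e2, transport_mul_apply g h hf] with x h1 h2 h3 h4
  rw [h2, h3, h1, h4]

theorem koopmanFun_one_apply {f : Ω → ℂ} (hf : Measurable f) :
    koopmanFun (1 : AutStar μ) f hf =ᵐ[μ] f := by
  have h1 : push (1 : AutStar μ) = μ := by
    ext s hs
    rw [push_apply _ hs]
    rfl
  have h2 := Measure.rnDeriv_self μ
  filter_upwards [transport_one_apply hf, h2] with x hx h2
  rw [koopmanFun, hx, h1, h2]
  simp

end KoopmanFun

/-! ### The Koopman representation on `L²`. -/

section Koopman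

variable {Ω : Type v} [MeasurableSpace Ω] {μ : Measure Ω} (g : AutStar μ)

theorem koopman_ae (f : Lp ℂ 2 μ) :
    koopman g f =ᵐ[μ] koopmanFun g f (Lp.stronglyMeasurable f).measurable :=
  MemLp.coeFn_toLp _

theorem koopman_ae_of_ae_eq {f : Lp ℂ 2 μ} {k : Ω → ℂ} (hk : Measurable k) (h : f =ᵐ[μ] k) :
    koopman g f =ᵐ[μ] koopmanFun g k hk :=
  (koopman_ae g f).trans (koopmanFun_congr g _ hk h)

theorem norm_eq_of_lintegral_eq {Ω' : Type w} [MeasurableSpace Ω'] {ν : Measure Ω'}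
    {f : Lp ℂ 2 μ} {k : Lp ℂ 2 ν}
    (h : ∫⁻ x, ‖f x‖ₑ ^ (2 : ℝ) ∂μ = ∫⁻ x, ‖k x‖ₑ ^ (2 : ℝ) ∂ν) : ‖f‖ = ‖k‖ := by
  rw [Lp.norm_def, Lp.norm_def,
    eLpNorm_eq_lintegral_rpow_enorm_toReal two_ne_zero ENNReal.ofNat_ne_top,
    eLpNorm_eq_lintegral_rpow_enorm_toReal two_ne_zero ENNReal.ofNat_ne_top]
  simp only [ENNReal.toReal_ofNat, h]

variable [SigmaFinite μ]

/-- The Koopman operator of an automorphism, as a linear isometry. -/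
noncomputable def koopmanIsometry : Lp ℂ 2 μ →ₗᵢ[ℝ] Lp ℂ 2 μ where
  toFun := koopman g
  map_add' f f' := by
    have h1 := (Lp.stronglyMeasurable f).measurable
    have h2 := (Lp.stronglyMeasurable f').measurable
    apply Lp.ext
    filter_upwards [koopman_ae_of_ae_eq g (h1.add h2) (Lp.coeFn_add f f'), koopman_ae g f,
      koopman_ae g f', koopmanFun_add g h1 h2 (h1.add h2),
      Lp.coeFn_add (koopman g f) (koopman g f')] with x a1 a2 a3 a4 a5
    rw [a5, a1, Pi.add_apply, a2, a3]
    exact a4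
  map_smul' c f := by
    have h1 := (Lp.stronglyMeasurable f).measurable
    have h2 : Measurable fun x => (c : ℂ) * f x := h1.const_mul _
    apply Lp.ext
    have h3 : (c • f : Lp ℂ 2 μ) =ᵐ[μ] fun x => (c : ℂ) * f x := by
      filter_upwards [Lp.coeFn_smul c f] with x hx
      rw [hx, Pi.smul_apply, Complex.real_smul]
    filter_upwards [koopman_ae_of_ae_eq g h2 h3, koopman_ae g f,
      koopmanFun_const_mul g c h1 h2, Lp.coeFn_smul c (koopman g f)] with x a1 a2 a3 a4
    rw [RingHom.id_apply, a4, a1, a3, Pi.smul_apply, a2, Complex.real_smul]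
  norm_map' f := by
    refine norm_eq_of_lintegral_eq ?_
    rw [← lintegral_koopmanFun g (Lp.stronglyMeasurable f).measurable]
    refine lintegral_congr_ae ?_
    filter_upwards [koopman_ae g f] with x hx
    exact congrArg (fun z => ‖z‖ₑ ^ (2 : ℝ)) hx

/-- The Koopman representation of `Aut*(μ)`. -/
noncomputable def koopmanHom (μ : Measure Ω) [SigmaFinite μ] :
    AutStar μ →* (Lp ℂ 2 μ →ₗᵢ[ℝ] Lp ℂ 2 μ) where
  toFun g := koopmanIsometry g
  map_one' := by
    ext1 f
    apply Lp.ext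
    exact (koopman_ae 1 f).trans (koopmanFun_one_apply _)
  map_mul' g h := by
    ext1 f
    apply Lp.ext
    have h1 := (Lp.stronglyMeasurable f).measurable
    exact ((koopman_ae (g * h) f).trans (koopmanFun_mul_apply g h h1)).trans
      (koopman_ae_of_ae_eq g (measurable_koopmanFun h h1) (koopman_ae h f)).symm

theorem continuous_koopmanHom (f : Lp ℂ 2 μ) : Continuous fun g : AutStar μ => koopmanHom μ g f :=
  (continuous_apply f).comp continuous_induced_dom

end Koopman

end AutStar

end NonsingularActions

namespace NonsingularActions

/-! ### Passing to an absolutely continuous measure -/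

namespace MeasureAlgebra

variable {Ω : Type v} [MeasurableSpace Ω] {μ ν : Measure Ω}

/-- The quotient map of measure algebras associated with an absolutely continuous measure. -/
def project (h : ν ≪ μ) : MeasureAlgebra μ → MeasureAlgebra ν :=
  Quotient.lift (fun s => mk ν (s : Set Ω) s.2) fun _ _ hst => mk_eq_mk.2 (h.ae_eq hst)

theorem project_mk (h : ν ≪ μ) {s : Set Ω} (hs : MeasurableSet s) :
    project h (mk μ s hs) = mk ν s hs := rfl

theorem project_surjective (h : ν ≪ μ) : Function.Surjective (project h) := by
  intro a
  obtain ⟨s, hs, rfl⟩ := exists_rep a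
  exact ⟨mk μ s hs, rfl⟩

theorem value_project (h : ν ≪ μ) (a : MeasureAlgebra μ) :
    value ν Measure.AbsolutelyContinuous.rfl (project h a) = value ν h a := by
  obtain ⟨s, hs, rfl⟩ := exists_rep a
  rfl

theorem project_le_project_iff (h : ν ≪ μ) {a b : MeasureAlgebra μ} :
    project h a ≤ project h b ↔ value ν h (a ⊓ bᶜ) = 0 := by
  obtain ⟨s, hs, rfl⟩ := exists_rep a
  obtain ⟨t, ht, rfl⟩ := exists_rep b
  rw [project_mk, project_mk, mk_le_mk, compl_mk, mk_inf_mk, value_mk, ae_le_set]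
  rfl

/-- For equivalent measures the measure algebras are isomorphic. -/
noncomputable def projectIso (h : ν ≪ μ) (h' : μ ≪ ν) : MeasureAlgebra μ ≃o MeasureAlgebra ν where
  toFun := project h
  invFun := project h'
  left_inv a := by obtain ⟨s, hs, rfl⟩ := exists_rep a; rfl
  right_inv a := by obtain ⟨s, hs, rfl⟩ := exists_rep a; rfl
  map_rel_iff' {a b} := by
    obtain ⟨s, hs, rfl⟩ := exists_rep a
    obtain ⟨t, ht, rfl⟩ := exists_rep b
    exact ⟨fun hst => h'.ae_le hst, fun hst => h.ae_le hst⟩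

end MeasureAlgebra

open MeasureAlgebra AutStar
open scoped ComplexOrder

section ProjectAction

variable {Ω : Type v} [MeasurableSpace Ω] {μ ν : Measure Ω}

/-- An automorphism preserving `ν` preserves the ideal of `ν`-null elements, hence the order of the
quotient. -/
theorem project_apply_le_iff (h : ν ≪ μ) {g : AutStar μ}
    (hg : ∀ a, value ν h (g a) = value ν h a) (a b : MeasureAlgebra μ) :
    project h (g a) ≤ project h (g b) ↔ project h a ≤ project h b := by
  rw [project_le_project_iff, project_le_project_iff, ← map_compl', ← OrderIso.map_inf, hg]

/-- An automorphism preserving `ν` induces an automorphism of the measure algebra of `ν`. -/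
noncomputable def projectAut (h : ν ≪ μ) (g : AutStar μ)
    (hg : ∀ a, value ν h (g a) = value ν h a) : AutStar ν :=
  let l := Function.surjInv (project_surjective h)
  have hl : ∀ a, project h (l a) = a := Function.surjInv_eq (project_surjective h)
  have hle : ∀ {a b}, project h (g (l a)) ≤ project h (g (l b)) ↔ a ≤ b := fun {a b} => by
    rw [project_apply_le_iff h hg, hl, hl]
  have hsurj : Function.Surjective fun a => project h (g (l a)) := fun b => by
    refine ⟨project h (g.symm (l b)), ?_⟩
    have : project h (g (l (project h (g.symm (l b))))) = project h (g (g.symm (l b))) := by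
      apply le_antisymm <;> rw [project_apply_le_iff h hg, hl]
    exact this.trans (by rw [OrderIso.apply_symm_apply, hl])
  { toEquiv := Equiv.ofBijective (fun a => project h (g (l a)))
      ⟨fun _ _ hab => le_antisymm (hle.1 hab.le) (hle.1 hab.ge), hsurj⟩
    map_rel_iff' := hle }

theorem projectAut_project (h : ν ≪ μ) (g : AutStar μ)
    (hg : ∀ a, value ν h (g a) = value ν h a) (a : MeasureAlgebra μ) :
    projectAut h g hg (project h a) = project h (g a) := by
  change project h (g (Function.surjInv (project_surjective h) (project h a))) = _
  apply le_antisymm <;> rw [project_apply_le_iff h hg, Function.surjInv_eq (project_surjective h)]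

/-- The action on the measure algebra of a preserved measure. -/
noncomputable def projectAction {Γ : Type u} [Group Γ] (ρ : Γ →* AutStar μ) (h : ν ≪ μ)
    (hp : Preserves ρ ν h) : Γ →* AutStar ν :=
  MonoidHom.mk' (fun g => projectAut h (ρ g) (hp g)) (by
    intro g k
    ext a
    obtain ⟨a, rfl⟩ := project_surjective h a
    simp only [RelIso.mul_apply, projectAut_project, map_mul])

theorem projectAction_project {Γ : Type u} [Group Γ] (ρ : Γ →* AutStar μ) (h : ν ≪ μ)
    (hp : Preserves ρ ν h) (g : Γ) (a : MeasureAlgebra μ) :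
    projectAction ρ h hp g (project h a) = project h (ρ g a) :=
  projectAut_project h (ρ g) (hp g) a

theorem isMeasurePreserving_projectAction {Γ : Type u} [Group Γ] (ρ : Γ →* AutStar μ) (h : ν ≪ μ)
    (hp : Preserves ρ ν h) : IsMeasurePreserving (projectAction ρ h hp) := by
  intro g a
  obtain ⟨a, rfl⟩ := project_surjective h a
  rw [projectAction_project, value_project, value_project]
  exact hp g a

/-- The square root of the density of `ν` with respect to `μ`. -/
noncomputable def sqrtDensity (ν μ : Measure Ω) : Ω → ℂ :=
  fun x => (Real.sqrt (ν.rnDeriv μ x).toReal : ℂ)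

theorem measurable_sqrtDensity (ν μ : Measure Ω) : Measurable (sqrtDensity ν μ) := by
  have := ν.measurable_rnDeriv μ
  unfold sqrtDensity
  fun_prop

theorem sqrtDensity_nonneg (x : Ω) : 0 ≤ sqrtDensity ν μ x :=
  Complex.zero_le_real.2 (Real.sqrt_nonneg _)

variable [SigmaFinite ν]

theorem enorm_sqrtDensity :
    (fun x => ‖sqrtDensity ν μ x‖ₑ ^ (2 : ℝ)) =ᵐ[μ] ν.rnDeriv μ := by
  filter_upwards [ν.rnDeriv_lt_top μ] with x hx
  rw [sqrtDensity, ← ofReal_norm, Complex.norm_real,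
    Real.norm_of_nonneg (Real.sqrt_nonneg _),
    ENNReal.ofReal_rpow_of_nonneg (Real.sqrt_nonneg _) zero_le_two, Real.rpow_two,
    Real.sq_sqrt ENNReal.toReal_nonneg, ENNReal.ofReal_toReal hx.ne]

variable [SigmaFinite μ]

theorem lintegral_mul_sqrtDensity (h : ν ≪ μ) {f : Ω → ℂ} (hf : Measurable f) :
    ∫⁻ x, ‖f x * sqrtDensity ν μ x‖ₑ ^ (2 : ℝ) ∂μ = ∫⁻ x, ‖f x‖ₑ ^ (2 : ℝ) ∂ν := by
  rw [← lintegral_rnDeriv_mul h (by fun_prop)]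
  refine lintegral_congr_ae ?_
  filter_upwards [enorm_sqrtDensity (ν := ν) (μ := μ)] with x hx
  rw [enorm_mul, ENNReal.mul_rpow_of_nonneg _ _ zero_le_two, hx, mul_comm]

theorem setLIntegral_sqrtDensity (h : ν ≪ μ) (s : Set Ω) :
    ∫⁻ x in s, ‖sqrtDensity ν μ x‖ₑ ^ (2 : ℝ) ∂μ = ν s := by
  rw [← Measure.setLIntegral_rnDeriv h s]
  exact lintegral_congr_ae (ae_restrict_of_ae enorm_sqrtDensity)

/-- Where the density vanishes both products are 0, and elsewhere `ν`-null sets are `μ`-null. -/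
theorem mul_sqrtDensity_ae_eq (h : ν ≪ μ) {f f' : Ω → ℂ} (hf : f =ᵐ[ν] f') :
    (fun x => f x * sqrtDensity ν μ x) =ᵐ[μ] fun x => f' x * sqrtDensity ν μ x := by
  have h1 : ∀ᵐ x ∂(μ.withDensity (ν.rnDeriv μ)), f x = f' x := by
    rw [Measure.withDensity_rnDeriv_eq ν μ h]
    exact hf
  rw [ae_withDensity_iff (ν.measurable_rnDeriv μ)] at h1
  filter_upwards [h1] with x hx
  by_cases h0 : ν.rnDeriv μ x = 0
  · simp [sqrtDensity, h0]
  · rw [hx h0]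

theorem memLp_mul_sqrtDensity (h : ν ≪ μ) (f : Lp ℂ 2 ν) :
    MemLp (fun x => f x * sqrtDensity ν μ x) 2 μ := by
  have hf := (Lp.stronglyMeasurable f).measurable
  refine ⟨(hf.mul (measurable_sqrtDensity ν μ)).aestronglyMeasurable, ?_⟩
  rw [eLpNorm_lt_top_iff_lintegral_rpow_enorm_lt_top two_ne_zero ENNReal.ofNat_ne_top]
  simp only [ENNReal.toReal_ofNat]
  rw [lintegral_mul_sqrtDensity h hf]
  simpa using (eLpNorm_lt_top_iff_lintegral_rpow_enorm_lt_top two_ne_zero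
    ENNReal.ofNat_ne_top).1 (Lp.memLp f).2

/-- The isometric embedding of `L²(ν)` into `L²(μ)`. -/
noncomputable def mulSqrtDensity (h : ν ≪ μ) (f : Lp ℂ 2 ν) : Lp ℂ 2 μ :=
  (memLp_mul_sqrtDensity h f).toLp _

theorem mulSqrtDensity_ae (h : ν ≪ μ) {f : Lp ℂ 2 ν} {f' : Ω → ℂ} (hf : f =ᵐ[ν] f') :
    mulSqrtDensity h f =ᵐ[μ] fun x => f' x * sqrtDensity ν μ x :=
  (MemLp.coeFn_toLp _).trans (mul_sqrtDensity_ae_eq h hf)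

theorem isometry_mulSqrtDensity (h : ν ≪ μ) : Isometry (mulSqrtDensity h) := by
  refine Isometry.of_dist_eq fun f f' => ?_
  rw [dist_eq_norm, dist_eq_norm]
  refine norm_eq_of_lintegral_eq ?_
  rw [← lintegral_mul_sqrtDensity h (Lp.stronglyMeasurable _).measurable]
  refine lintegral_congr_ae ?_
  filter_upwards [Lp.coeFn_sub (mulSqrtDensity h f) (mulSqrtDensity h f'),
    mulSqrtDensity_ae h (EventuallyEq.refl (ae ν) f),
    mulSqrtDensity_ae h (EventuallyEq.refl (ae ν) f'),
    mul_sqrtDensity_ae_eq h (Lp.coeFn_sub f f')] with x h1 h2 h3 h4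
  rw [h1, h4, Pi.sub_apply, Pi.sub_apply, h2, h3, sub_mul]

theorem koopmanFun_sqrtDensity (h : ν ≪ μ) {g : AutStar μ}
    (hg : ∀ a, value ν h (g a) = value ν h a) :
    koopmanFun g (sqrtDensity ν μ) (measurable_sqrtDensity ν μ) =ᵐ[μ] sqrtDensity ν μ := by
  refine ae_eq_of_setLIntegral_eq (measurable_koopmanFun _ _) (measurable_sqrtDensity ν μ)
    (koopmanFun_nonneg g _ (Eventually.of_forall sqrtDensity_nonneg))
    (Eventually.of_forall sqrtDensity_nonneg) fun t ht => ?_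
  obtain ⟨s, hs, hst⟩ := exists_rep (g.symm (mk μ t ht))
  have h1 : mk μ t ht = g (mk μ s hs) := by rw [hst, OrderIso.apply_symm_apply]
  rw [setLIntegral_koopmanFun g _ hs ht h1, setLIntegral_sqrtDensity h, setLIntegral_sqrtDensity h]
  have := hg (mk μ s hs)
  rw [← h1, value_mk, value_mk] at this
  exact this.symm

/-- As `g` preserves `ν`, it fixes the square root of the density, and the Koopman operator on
`L²(ν)` is plain transport. The embedding is therefore equivariant, and continuity of the projected
action can be checked in `L²(μ)`. -/
theorem mulSqrtDensity_koopman (h : ν ≪ μ) {g : AutStar μ}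
    (hg : ∀ a, value ν h (g a) = value ν h a) (f : Lp ℂ 2 ν) :
    mulSqrtDensity h (koopman (projectAut h g hg) f) = koopman g (mulSqrtDensity h f) := by
  have hf := (Lp.stronglyMeasurable f).measurable
  set g' := projectAut h g hg
  have h1 : push g' = ν := by
    ext t ht
    obtain ⟨s, hs, hst⟩ := exists_rep (g.symm (mk μ t ht))
    have h1 : mk μ t ht = g (mk μ s hs) := by rw [hst, OrderIso.apply_symm_apply]
    have h2 : mk ν t ht = g' (mk ν s hs) := by
      rw [← project_mk h, ← project_mk h, projectAut_project, h1]
    rw [push_of_mk_eq g' hs ht h2]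
    have := hg (mk μ s hs)
    rw [← h1, value_mk, value_mk] at this
    exact this.symm
  have h2 : koopman g' f =ᵐ[ν] transport g' f hf := by
    have h3 := Measure.rnDeriv_self ν
    filter_upwards [koopman_ae g' f, h3] with x hx h3
    rw [hx, koopmanFun, h1, h3]
    simp
  have h3 : transport g f hf =ᵐ[ν] transport g' f hf := by
    refine transport_unique g' f hf _ (measurable_transport g f hf) fun B hB => ?_
    rw [← project_mk h, ← project_mk h, projectAut_project, transport_spec g f hf hB]
  have h4 := mulSqrtDensity_ae h (h2.trans h3.symm)
  have hw := measurable_sqrtDensity ν μ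
  have h5 := koopman_ae_of_ae_eq g (hf.mul hw) (mulSqrtDensity_ae h (EventuallyEq.refl (ae ν) f))
  apply Lp.ext
  filter_upwards [h4, h5, koopmanFun_mul g hf hw (hf.mul hw), koopmanFun_sqrtDensity h hg]
    with x h4 h5 h6 h7
  rw [h4, h5]
  exact (h6.trans (by rw [h7])).symm

/-- A non-singular action which preserves `ν` gives a measure-preserving non-singular action on
the measure algebra of `ν`. -/
noncomputable def projectNonsingularAction {Γ : Type u} [Group Γ] [TopologicalSpace Γ]
    (ρ : NonsingularAction Γ μ) (h : ν ≪ μ) (hp : Preserves (ρ : Γ →* AutStar μ) ν h) :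
    NonsingularAction Γ ν where
  toMonoidHom := projectAction (ρ : Γ →* AutStar μ) h hp
  continuous_toFun := by
    refine continuous_induced_rng.2 (continuous_pi fun f => ?_)
    refine (isometry_mulSqrtDensity h).isUniformInducing.isInducing.continuous_iff.2 ?_
    have : (mulSqrtDensity h ∘ fun g : Γ =>
        koopman (projectAction (ρ : Γ →* AutStar μ) h hp g) f) =
        fun g => koopmanHom μ (ρ g) (mulSqrtDensity h f) := by
      funext g
      exact mulSqrtDensity_koopman h (hp g) f
    exact this ▸ (continuous_koopmanHom _).comp ρ.continuous_toFun

end ProjectAction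

end NonsingularActions

namespace NonsingularActions

open MeasureAlgebra AutStar
open scoped ComplexOrder RealInnerProductSpace

/-! ### Nonnegative square-integrable functions -/

section Support

variable {Ω : Type v} [MeasurableSpace Ω] {μ : Measure Ω}

theorem measurableSet_support_lp (f : Lp ℂ 2 μ) : MeasurableSet (Function.support f) :=
  measurableSet_support (Lp.stronglyMeasurable f).measurable

/-- The support of a square-integrable function. -/
def suppClass (f : Lp ℂ 2 μ) : MeasureAlgebra μ :=
  mk μ (Function.support f) (measurableSet_support_lp f)

/-- The measure with density `|f|²`. -/
noncomputable def sqMeasure (f : Lp ℂ 2 μ) : Measure Ω :=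
  μ.withDensity fun x => ‖f x‖ₑ ^ (2 : ℝ)

theorem measurable_enorm_sq (f : Lp ℂ 2 μ) : Measurable fun x => ‖f x‖ₑ ^ (2 : ℝ) := by
  have := (Lp.stronglyMeasurable f).measurable
  fun_prop

theorem sqMeasure_absolutelyContinuous (f : Lp ℂ 2 μ) : sqMeasure f ≪ μ :=
  withDensity_absolutelyContinuous _ _

instance isFiniteMeasure_sqMeasure (f : Lp ℂ 2 μ) : IsFiniteMeasure (sqMeasure f) := by
  refine isFiniteMeasure_withDensity ?_
  have := (eLpNorm_lt_top_iff_lintegral_rpow_enorm_lt_top two_ne_zero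
    ENNReal.ofNat_ne_top).1 (Lp.memLp f).2
  simpa using this.ne

theorem value_sqMeasure_eq_zero_iff (f : Lp ℂ 2 μ) (a : MeasureAlgebra μ) :
    value (sqMeasure f) (sqMeasure_absolutelyContinuous f) a = 0 ↔ Disjoint a (suppClass f) := by
  obtain ⟨s, hs, rfl⟩ := exists_rep a
  rw [value_mk, sqMeasure, withDensity_apply_eq_zero (measurable_enorm_sq f), disjoint_iff,
    suppClass, mk_inf_mk, bot_eq, mk_eq_mk, ae_eq_empty, inter_comm]
  congr! 3
  ext x
  simp

theorem suppClass_ne_bot {f : Lp ℂ 2 μ} (hf : f ≠ 0) : suppClass f ≠ ⊥ := by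
  intro h
  rw [suppClass, bot_eq, mk_eq_mk, ae_eq_empty] at h
  refine hf ((Lp.eq_zero_iff_ae_eq_zero).2 ?_)
  exact measure_eq_zero_iff_ae_notMem.1 h |>.mono fun x hx => by simpa using hx

/-- The function is nonnegative and vanishes outside of `A`. -/
def nonnegOn (μ : Measure Ω) (A : Set Ω) : Set (Lp ℂ 2 μ) :=
  {f | ∀ᵐ x ∂μ, 0 ≤ f x ∧ (x ∉ A → f x = 0)}

theorem suppClass_le {f : Lp ℂ 2 μ} {A : Set Ω} (hA : MeasurableSet A) (hf : f ∈ nonnegOn μ A) :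
    suppClass f ≤ mk μ A hA := by
  refine mk_le_mk.2 ?_
  have hf' : ∀ᵐ x ∂μ, 0 ≤ f x ∧ (x ∉ A → f x = 0) := hf
  filter_upwards [hf'] with x hx
  intro h
  by_contra hn
  exact h (hx.2 hn)

/-- An `L²`-convergent sequence has a subsequence converging almost everywhere, and both conditions
pass to pointwise limits. -/
theorem isClosed_nonnegOn (A : Set Ω) : IsClosed (nonnegOn μ A) := by
  refine isClosed_of_closure_subset fun f hf => ?_
  obtain ⟨u, hu, hlim⟩ := mem_closure_iff_seq_limit.1 hf
  obtain ⟨n, -, hn⟩ := (tendstoInMeasure_of_tendsto_Lp hlim).exists_seq_tendsto_ae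
  have hu' : ∀ᵐ x ∂μ, ∀ n, 0 ≤ u n x ∧ (x ∉ A → u n x = 0) := ae_all_iff.2 hu
  change ∀ᵐ x ∂μ, _
  filter_upwards [hn, hu'] with x hx hux
  refine ⟨ge_of_tendsto' hx fun i => (hux _).1, fun hxA => tendsto_nhds_unique hx ?_⟩
  simp only [fun i => (hux i).2 hxA]
  exact tendsto_const_nhds

theorem add_mem_nonnegOn {A : Set Ω} {f k : Lp ℂ 2 μ} (hf : f ∈ nonnegOn μ A)
    (hk : k ∈ nonnegOn μ A) : f + k ∈ nonnegOn μ A := by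
  have hf' : ∀ᵐ x ∂μ, 0 ≤ f x ∧ (x ∉ A → f x = 0) := hf
  have hk' : ∀ᵐ x ∂μ, 0 ≤ k x ∧ (x ∉ A → k x = 0) := hk
  change ∀ᵐ x ∂μ, _
  filter_upwards [hf', hk', Lp.coeFn_add f k] with x h1 h2 h3
  rw [h3, Pi.add_apply]
  exact ⟨add_nonneg h1.1 h2.1, fun hx => by rw [h1.2 hx, h2.2 hx, add_zero]⟩

theorem smul_mem_nonnegOn {A : Set Ω} {f : Lp ℂ 2 μ} (hf : f ∈ nonnegOn μ A) {c : ℝ}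
    (hc : 0 ≤ c) : c • f ∈ nonnegOn μ A := by
  have hf' : ∀ᵐ x ∂μ, 0 ≤ f x ∧ (x ∉ A → f x = 0) := hf
  change ∀ᵐ x ∂μ, _
  filter_upwards [hf', Lp.coeFn_smul c f] with x h1 h3
  rw [h3, Pi.smul_apply, Complex.real_smul]
  exact ⟨mul_nonneg (Complex.zero_le_real.2 hc) h1.1, fun hx => by rw [h1.2 hx, mul_zero]⟩

theorem zero_mem_nonnegOn (A : Set Ω) : (0 : Lp ℂ 2 μ) ∈ nonnegOn μ A := by
  change ∀ᵐ x ∂μ, 0 ≤ (0 : Lp ℂ 2 μ) x ∧ (x ∉ A → (0 : Lp ℂ 2 μ) x = 0)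
  filter_upwards [Lp.coeFn_zero ℂ 2 μ] with x hx
  rw [hx]
  exact ⟨le_rfl, fun _ => rfl⟩

theorem convex_nonnegOn (A : Set Ω) : Convex ℝ (nonnegOn μ A) :=
  fun _ hf _ hk _ _ ha hb _ => add_mem_nonnegOn (smul_mem_nonnegOn hf ha) (smul_mem_nonnegOn hk hb)

theorem inner_nonneg_ae {f k : Lp ℂ 2 μ} {A B : Set Ω} (hf : f ∈ nonnegOn μ A)
    (hk : k ∈ nonnegOn μ B) : 0 ≤ᵐ[μ] fun x => ⟪f x, k x⟫ := by
  have hf' : ∀ᵐ x ∂μ, 0 ≤ f x ∧ (x ∉ A → f x = 0) := hf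
  have hk' : ∀ᵐ x ∂μ, 0 ≤ k x ∧ (x ∉ B → k x = 0) := hk
  filter_upwards [hf', hk'] with x h1 h2
  have h3 := Complex.nonneg_iff.1 h1.1
  have h4 := Complex.nonneg_iff.1 h2.1
  simp only [Pi.zero_apply, Complex.inner, Complex.mul_re, Complex.conj_re, Complex.conj_im, ← h3.2,
    neg_zero, mul_zero, sub_zero]
  exact mul_nonneg h4.1 h3.1

theorem inner_nonneg_of_mem {f k : Lp ℂ 2 μ} {A B : Set Ω} (hf : f ∈ nonnegOn μ A)
    (hk : k ∈ nonnegOn μ B) : 0 ≤ ⟪f, k⟫ := by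
  rw [L2.inner_def]
  exact integral_nonneg_of_ae (inner_nonneg_ae hf hk)

/-- The integrand of the inner product is nonnegative, so a zero integral makes the product vanish
almost everywhere. This is the passage from Hilbert space geometry to sets. -/
theorem disjoint_suppClass {f k : Lp ℂ 2 μ} {A B : Set Ω} (hf : f ∈ nonnegOn μ A)
    (hk : k ∈ nonnegOn μ B) (h : ⟪f, k⟫ = 0) : Disjoint (suppClass f) (suppClass k) := by
  rw [L2.inner_def, integral_eq_zero_iff_of_nonneg_ae (inner_nonneg_ae hf hk)
    (L2.integrable_inner f k)] at h
  rw [disjoint_iff, suppClass, suppClass, mk_inf_mk, bot_eq, mk_eq_mk, ae_eq_empty,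
    measure_eq_zero_iff_ae_notMem]
  have hf' : ∀ᵐ x ∂μ, 0 ≤ f x ∧ (x ∉ A → f x = 0) := hf
  have hk' : ∀ᵐ x ∂μ, 0 ≤ k x ∧ (x ∉ B → k x = 0) := hk
  filter_upwards [h, hf', hk'] with x hx h1 h2
  have h3 := Complex.nonneg_iff.1 h1.1
  have h4 := Complex.nonneg_iff.1 h2.1
  simp only [Pi.zero_apply, Complex.inner, Complex.mul_re, Complex.conj_re, Complex.conj_im, ← h3.2,
    neg_zero, mul_zero, sub_zero, mul_eq_zero] at hx
  rintro ⟨hfx, hkx⟩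
  rcases hx with hx | hx
  · exact hkx (Complex.ext hx h4.2.symm)
  · exact hfx (Complex.ext hx h3.2.symm)

theorem exists_nonzero_mem_nonnegOn [SigmaFinite μ] {A : Set Ω} (hA : MeasurableSet A)
    (h : μ A ≠ 0) : ∃ f ∈ nonnegOn μ A, f ≠ 0 := by
  obtain ⟨B, hB, hBA, hB0, hBtop⟩ :=
    Measure.exists_subset_measure_lt_top hA (pos_iff_ne_zero.2 h)
  refine ⟨indicatorConstLp 2 hB hBtop.ne (1 : ℂ), ?_, fun h0 => ?_⟩
  · change ∀ᵐ x ∂μ, _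
    filter_upwards [indicatorConstLp_coeFn (p := 2) (hs := hB) (hμs := hBtop.ne) (c := (1 : ℂ))]
      with x hx
    rw [hx]
    refine ⟨indicator_nonneg (fun _ _ => zero_le_one) x, fun hxA => ?_⟩
    exact indicator_of_notMem (fun hxB => hxA (hBA hxB)) _
  · have := norm_indicatorConstLp (p := 2) (hs := hB) (hμs := hBtop.ne) (c := (1 : ℂ)) (by simp)
      (by simp)
    rw [h0, norm_zero, norm_one, one_mul, eq_comm,
      Real.rpow_eq_zero (by positivity) (by simp), Measure.real,
      ENNReal.toReal_eq_zero_iff] at this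
    rcases this with h1 | h1
    · exact hB0.ne' h1
    · exact hBtop.ne h1

variable (g : AutStar μ)

theorem koopman_mem_nonnegOn {A : Set Ω} (hA : MeasurableSet A) (hg : g (mk μ A hA) = mk μ A hA)
    {f : Lp ℂ 2 μ} (hf : f ∈ nonnegOn μ A) : koopman g f ∈ nonnegOn μ A := by
  have hf' : ∀ᵐ x ∂μ, 0 ≤ f x ∧ (x ∉ A → f x = 0) := hf
  have hm := (Lp.stronglyMeasurable f).measurable
  have h1 : f =ᵐ[μ] A.indicator f := by
    filter_upwards [hf'] with x hx
    by_cases hxA : x ∈ A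
    · simp [hxA]
    · simp [hxA, hx.2 hxA]
  have h2 := koopmanFun_nonneg g hm (hf'.mono fun x hx => hx.1)
  change ∀ᵐ x ∂μ, _
  filter_upwards [koopman_ae g f, koopman_ae_of_ae_eq g (hm.indicator hA) h1, h2,
    koopmanFun_indicator g hm hA hA hg.symm (hm.indicator hA)] with x h3 h4 h5 h6
  refine ⟨h3 ▸ h5, fun hx => ?_⟩
  rw [h4, h6, indicator_of_notMem hx]

variable [SigmaFinite μ]

theorem value_sqMeasure_koopman (f : Lp ℂ 2 μ) (a : MeasureAlgebra μ) :
    value (sqMeasure (koopman g f)) (sqMeasure_absolutelyContinuous _) (g a) =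
      value (sqMeasure f) (sqMeasure_absolutelyContinuous _) a := by
  obtain ⟨s, hs, rfl⟩ := exists_rep a
  obtain ⟨t, ht, hts⟩ := exists_rep (g (mk μ s hs))
  have hm := (Lp.stronglyMeasurable f).measurable
  rw [← hts, value_mk, value_mk, sqMeasure, sqMeasure, withDensity_apply _ hs,
    withDensity_apply _ ht, ← setLIntegral_koopmanFun g hm hs ht hts]
  refine lintegral_congr_ae (ae_restrict_of_ae ?_)
  filter_upwards [koopman_ae g f] with x hx
  rw [hx]

/-- An element of a Boolean algebra is determined by the elements disjoint from it, and those
disjoint from a support are the null elements of the measure `|f|² μ`, which `g` carries along. -/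
theorem suppClass_koopman (f : Lp ℂ 2 μ) : suppClass (koopman g f) = g (suppClass f) := by
  have key : ∀ a, Disjoint a (suppClass (koopman g f)) ↔ Disjoint a (g (suppClass f)) := by
    intro a
    obtain ⟨a, rfl⟩ := g.surjective a
    rw [← value_sqMeasure_eq_zero_iff, value_sqMeasure_koopman, value_sqMeasure_eq_zero_iff,
      disjoint_map_orderIso_iff]
  apply le_antisymm
  · rw [← disjoint_compl_left_iff, key]
    exact disjoint_compl_left
  · rw [← disjoint_compl_left_iff, ← key]
    exact disjoint_compl_left

end Support

/-! ### Pieces -/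

section Piece

variable {G : Type u} [Group G] [TopologicalSpace G] {Ω : Type v} [MeasurableSpace Ω]
  {μ : Measure Ω}

/-- A nonnegative square-integrable function whose stabilizer `V` is an open self-commensurating
subgroup, and whose support is disjoint from its translates by elements outside of `V`. -/
structure InducedPiece (π : G →* AutStar μ) where
  /-- The function. -/
  vec : Lp ℂ 2 μ
  /-- The subgroup. -/
  subgroup : Subgroup G
  vec_ne_zero : vec ≠ 0
  isOpen_subgroup : IsOpen (subgroup : Set G)
  selfCommensurating : IsSelfCommensurating subgroup
  koopman_vec : ∀ g ∈ subgroup, koopman (π g) vec = vec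
  disjoint_of_notMem : ∀ g ∉ subgroup, Disjoint (π g (suppClass vec)) (suppClass vec)

variable [SigmaFinite μ] (π : NonsingularAction G μ)

theorem exists_inducedPiece [NonarchimedeanGroup G] (hG : IsRoelckePrecompact G)
    {A : MeasureAlgebra μ} (hA : A ≠ ⊥) (hinv : ∀ g, π g A = A) :
    ∃ p : InducedPiece (π : G →* AutStar μ), suppClass p.vec ≤ A := by
  obtain ⟨A, hAm, rfl⟩ := exists_rep A
  have hA0 : μ A ≠ 0 := fun h => hA (by rw [bot_eq, mk_eq_mk]; exact ae_eq_empty.2 h)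
  obtain ⟨f₀, hf₀, hne⟩ := exists_nonzero_mem_nonnegOn hAm hA0
  obtain ⟨ξ, hξ, hξ0, V, hVo, hVc, hV, hV'⟩ := exists_induced_vector
    ((koopmanHom μ).comp (π : G →* AutStar μ)) hG
    (fun f => (continuous_koopmanHom f).comp π.continuous_toFun) (convex_nonnegOn A)
    (isClosed_nonnegOn A) (fun g f hf => koopman_mem_nonnegOn (π g) hAm (hinv g) hf)
    (zero_mem_nonnegOn A) (fun a ha b hb => add_mem_nonnegOn ha hb)
    (fun a ha b hb => inner_nonneg_of_mem ha hb) hf₀ hne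
  refine ⟨⟨ξ, V, hξ0, hVo, hVc, hV, fun g hg => ?_⟩, suppClass_le hAm hξ⟩
  have := disjoint_suppClass (koopman_mem_nonnegOn (π g) hAm (hinv g) hξ) hξ (hV' g hg)
  rwa [suppClass_koopman] at this

theorem countable_quotient_of_isOpen {G : Type u} [Group G] [TopologicalSpace G]
    [IsTopologicalGroup G] [TopologicalSpace.SeparableSpace G] {V : Subgroup G}
    (hV : IsOpen (V : Set G)) :
    Countable (G ⧸ V) := by
  have := QuotientGroup.discreteTopology hV
  have : TopologicalSpace.SeparableSpace (G ⧸ V) :=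
    QuotientGroup.mk_surjective.denseRange.separableSpace continuous_quotient_mk'
  exact TopologicalSpace.separableSpace_iff_countable.1 inferInstance

end Piece

/-! ### Countable suprema and the countable chain condition. -/

namespace MeasureAlgebra

variable {Ω : Type v} [MeasurableSpace Ω] {μ : Measure Ω}

theorem exists_isLUB_range {J : Sort w} [Countable J] (a : J → MeasureAlgebra μ) :
    ∃ b, IsLUB (range a) b := by
  choose s hs hsa using fun j => exists_rep (a j)
  refine ⟨mk μ (⋃ j, s j) (MeasurableSet.iUnion hs), ?_, ?_⟩
  · rintro _ ⟨j, rfl⟩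
    rw [← hsa]
    exact mk_le_mk.2 (Eventually.of_forall fun x hx => Set.mem_iUnion.2 ⟨j, hx⟩)
  · intro b hb
    obtain ⟨t, ht, rfl⟩ := exists_rep b
    have h : ∀ j, s j ≤ᵐ[μ] t := fun j => by
      rw [← mk_le_mk (hs := hs j) (ht := ht), hsa]
      exact hb ⟨j, rfl⟩
    refine mk_le_mk.2 ?_
    filter_upwards [ae_all_iff.2 h] with x hx hx'
    obtain ⟨j, hj⟩ := Set.mem_iUnion.1 hx'
    exact hx j hj

theorem countable_of_pairwise_disjoint [SigmaFinite μ] {J : Type w} (a : J → MeasureAlgebra μ)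
    (ha : ∀ j, a j ≠ ⊥) (hd : Pairwise (Function.onFun Disjoint a)) : Countable J := by
  choose s hs hsa using fun j => exists_rep (a j)
  have h : Set.Countable {j | 0 < μ (s j)} := Measure.countable_meas_pos_of_disjoint_iUnion₀ (μ := μ) (As := s)
    (fun j => (hs j).nullMeasurableSet) (fun i j hij => by
      have := hd hij
      rw [Function.onFun, ← hsa, ← hsa, disjoint_iff, mk_inf_mk, bot_eq, mk_eq_mk,
        ae_eq_empty] at this
      exact this)
  have h2 : {j | 0 < μ (s j)} = Set.univ := by
    refine Set.eq_univ_of_forall fun j => ?_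
    change 0 < μ (s j)
    refine pos_iff_ne_zero.2 fun h0 => ha j ?_
    rw [← hsa, bot_eq, mk_eq_mk]
    exact ae_eq_empty.2 h0
  rw [h2] at h
  exact Set.countable_univ_iff.1 h

end MeasureAlgebra

section Orbit

variable {G : Type u} [Group G] {Ω : Type v} [MeasurableSpace Ω] {μ : Measure Ω}

theorem apply_eq_of_isLUB_orbit (π : G →* AutStar μ) {J : Type w} {a : J → MeasureAlgebra μ}
    {e : MeasureAlgebra μ} (he : IsLUB (range fun p : G × J => π p.1 (a p.2)) e) (g : G) :
    π g e = e := by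
  have h1 := (OrderIso.isLUB_image' (π g)).2 he
  refine h1.unique ?_
  convert he using 1
  rw [← Set.range_comp]
  apply Subset.antisymm
  · rintro _ ⟨⟨h, j⟩, rfl⟩
    exact ⟨(g * h, j), by simp only [map_mul]; rfl⟩
  · rintro _ ⟨⟨h, j⟩, rfl⟩
    refine ⟨(g⁻¹ * h, j), ?_⟩
    change π g (π (g⁻¹ * h) (a j)) = _
    rw [← RelIso.mul_apply, ← map_mul, mul_inv_cancel_left]

end Orbit

/-! ### Saturations of pieces and exhaustion. -/

section Exhaustion

variable {G : Type u} [Group G] [TopologicalSpace G] {Ω : Type v} [MeasurableSpace Ω]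
  {μ : Measure Ω} [SigmaFinite μ]

theorem InducedPiece.apply_out (π : G →* AutStar μ) (p : InducedPiece π) (g : G) :
    π (g : G ⧸ p.subgroup).out (suppClass p.vec) = π g (suppClass p.vec) := by
  obtain ⟨h, hh⟩ := QuotientGroup.mk_out_eq_mul p.subgroup g
  rw [hh, map_mul, RelIso.mul_apply, ← suppClass_koopman (π (h : G)), p.koopman_vec _ h.2]

/-- Only countable suprema are constructed directly; the translates depend only on the coset, and
there are countably many cosets of an open subgroup. -/
theorem InducedPiece.exists_saturation [IsTopologicalGroup G] [TopologicalSpace.SeparableSpace G]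
    (π : G →* AutStar μ) (p : InducedPiece π) :
    ∃ e, IsLUB (range fun x : G ⧸ p.subgroup => π x.out (suppClass p.vec)) e ∧
      IsLUB (range fun g => π g (suppClass p.vec)) e := by
  have := countable_quotient_of_isOpen p.isOpen_subgroup
  obtain ⟨e, he⟩ := exists_isLUB_range fun x : G ⧸ p.subgroup => π x.out (suppClass p.vec)
  have : (range fun x : G ⧸ p.subgroup => π x.out (suppClass p.vec)) =
      range fun g => π g (suppClass p.vec) := by
    apply Subset.antisymm
    · rintro _ ⟨x, rfl⟩
      exact ⟨_, rfl⟩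
    · rintro _ ⟨g, rfl⟩
      exact ⟨g, p.apply_out π g⟩
  exact ⟨e, he, this ▸ he⟩

/-- A measure algebra with a non-singular action is exhausted by countably many pieces. -/
theorem exists_exhaustion [NonarchimedeanGroup G] [TopologicalSpace.SeparableSpace G]
    (hG : IsRoelckePrecompact G) (π : NonsingularAction G μ) :
    ∃ (ι : Type) (_ : Countable ι) (p : ι → InducedPiece (π : G →* AutStar μ)),
      (∀ i j, i ≠ j → ∀ g, Disjoint (suppClass (p i).vec) (π g (suppClass (p j).vec))) ∧
      ∀ b, (∀ i g, π g (suppClass (p i).vec) ≤ b) → b = ⊤ := by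
  let R : InducedPiece (π : G →* AutStar μ) → InducedPiece (π : G →* AutStar μ) → Prop :=
    fun p q => ∀ g, Disjoint (suppClass p.vec) (π g (suppClass q.vec))
  obtain ⟨S, hS⟩ := zorn_subset {S | S.Pairwise R} (by
    intro c hc hchain
    refine ⟨⋃₀ c, (Set.pairwise_sUnion hchain.directedOn).2 fun s hs => hc hs,
      fun s hs => Set.subset_sUnion_of_mem hs⟩)
  have hSR : S.Pairwise R := hS.1
  have hSc : Countable S := by
    refine countable_of_pairwise_disjoint (fun p : S => suppClass p.1.vec)
      (fun p => suppClass_ne_bot p.1.vec_ne_zero) fun p q hpq => ?_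
    have := hSR p.2 q.2 (fun h => hpq (Subtype.ext h)) 1
    rwa [map_one] at this
  -- The family is countable, so it can be indexed by a type in the lowest universe.
  have : Small.{0} S := Countable.toSmall S
  let e := equivShrink.{0} S
  refine ⟨Shrink.{0} S, e.symm.injective.countable, fun i => (e.symm i).1, ?_, ?_⟩
  · intro i j hij
    exact hSR (e.symm i).2 (e.symm j).2 fun h => hij (e.symm.injective (Subtype.ext h))
  · intro b hb
    have hb' : ∀ p ∈ S, ∀ g, π g (suppClass p.vec) ≤ b := fun p hp g => by
      have := hb (e ⟨p, hp⟩) g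
      simp only [Equiv.symm_apply_apply] at this
      exact this
    choose s hs1 hs2 using fun p : S => p.1.exists_saturation (π : G →* AutStar μ)
    obtain ⟨E, hE⟩ := exists_isLUB_range s
    have hE' : IsLUB (range fun q : G × S => (π : G →* AutStar μ) q.1 (suppClass q.2.1.vec)) E := by
      constructor
      · rintro _ ⟨⟨g, p⟩, rfl⟩
        exact ((hs2 p).1 ⟨g, rfl⟩).trans (hE.1 ⟨p, rfl⟩)
      · intro c hc
        refine hE.2 ?_
        rintro _ ⟨p, rfl⟩
        refine (hs2 p).2 ?_
        rintro _ ⟨g, rfl⟩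
        exact hc ⟨(g, p), rfl⟩
    have hinv := apply_eq_of_isLUB_orbit (π : G →* AutStar μ)
      (a := fun p : S => suppClass p.1.vec) hE'
    have hEb : E ≤ b := hE'.2 (by
      rintro _ ⟨⟨g, p⟩, rfl⟩
      exact hb' p.1 p.2 g)
    by_contra hbt
    -- The complement of the invariant element `E` is invariant, so if it were nonzero it would
    -- contain a new piece, against maximality.
    have hEc : Eᶜ ≠ ⊥ := fun h => hbt (top_le_iff.1 (compl_eq_bot.1 h ▸ hEb))
    obtain ⟨q, hq⟩ := exists_inducedPiece π hG hEc fun g => by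
      rw [map_compl']
      exact congrArg _ (hinv g)
    have hqE : ∀ p ∈ S, ∀ g, Disjoint (suppClass q.vec) (π g (suppClass p.vec)) := fun p hp g =>
      disjoint_compl_left.mono hq (hE'.1 ⟨(g, ⟨p, hp⟩), rfl⟩)
    have hqS : q ∉ S := fun h => by
      have := hqE q h 1
      rw [map_one] at this
      exact suppClass_ne_bot q.vec_ne_zero (disjoint_self.1 this)
    refine hqS (hS.2 (y := insert q S) ?_ (Set.subset_insert q S) (Set.mem_insert q S))
    refine hSR.insert fun p hp _ => ⟨hqE p hp, fun g => ?_⟩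
    have := hqE p hp g⁻¹
    rw [← disjoint_map_orderIso_iff (π g), ← RelIso.mul_apply, ← map_mul, mul_inv_cancel,
      map_one] at this
    exact this.symm

end Exhaustion

end NonsingularActions

namespace NonsingularActions

open MeasureAlgebra AutStar

/-! ### Gluing -/

section Reduction

/-- The map `q` identifies the quotient of `B` by the ideal of all elements disjoint from `e`
with `B'`. -/
def IsReduction {B : Type v} {B' : Type w} [BooleanAlgebra B] [PartialOrder B'] (q : B → B')
    (e : B) : Prop :=
  Function.Surjective q ∧ ∀ a b, q a ≤ q b ↔ a ⊓ e ≤ b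

theorem IsReduction.orderIso_comp {B : Type v} {B' : Type w} [BooleanAlgebra B] [PartialOrder B']
    {q : B → B'} {e : B} (hq : IsReduction q e) {B'' : Type u} [PartialOrder B''] (φ : B' ≃o B'') :
    IsReduction (fun a => φ (q a)) e :=
  ⟨φ.surjective.comp hq.1, fun a b => by rw [φ.le_iff_le, hq.2]⟩

theorem IsReduction.comp_orderIso {B : Type v} {B' : Type w} [BooleanAlgebra B] [PartialOrder B']
    {q : B → B'} {e : B} (hq : IsReduction q e) (g : B ≃o B) :
    IsReduction (fun a => q (g.symm a)) (g e) :=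
  ⟨hq.1.comp g.symm.surjective, fun a b => by
    rw [hq.2, ← g.le_iff_le, OrderIso.map_inf, OrderIso.apply_symm_apply,
      OrderIso.apply_symm_apply]⟩

/-- A reduction to the whole algebra is an isomorphism. -/
noncomputable def IsReduction.orderIso {B : Type v} {B' : Type w} [BooleanAlgebra B]
    [PartialOrder B'] {q : B → B'} (hq : IsReduction q ⊤) : B ≃o B' where
  toEquiv := Equiv.ofBijective q ⟨fun a b hab => le_antisymm
    (by simpa using (hq.2 a b).1 hab.le) (by simpa using (hq.2 b a).1 hab.ge), hq.1⟩
  map_rel_iff' {a b} := by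
    change q a ≤ q b ↔ a ≤ b
    simpa using hq.2 a b

theorem IsReduction.orderIso_apply {B : Type v} {B' : Type w} [BooleanAlgebra B]
    [PartialOrder B'] {q : B → B'} (hq : IsReduction q ⊤) (a : B) : hq.orderIso a = q a := rfl

/-- Meeting with `a` is left adjoint to `a ⇨ ·`, so it respects whichever suprema exist. -/
theorem inf_le_iff_of_isLUB {B : Type v} [BooleanAlgebra B] {S : Set B} {e : B} (he : IsLUB S e)
    (a b : B) : a ⊓ e ≤ b ↔ ∀ s ∈ S, a ⊓ s ≤ b := by
  rw [inf_comm, ← le_himp_iff, isLUB_le_iff he]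
  refine forall₂_congr fun s _ => ?_
  rw [inf_comm, ← le_himp_iff]

theorem isReduction_pi {Ω : Type v} [MeasurableSpace Ω] {μ : Measure Ω} {J : Type u} [Countable J]
    {B : J → Type w} [∀ j, PartialOrder (B j)] {q : ∀ j, MeasureAlgebra μ → B j}
    {e : J → MeasureAlgebra μ} {E : MeasureAlgebra μ} (hq : ∀ j, IsReduction (q j) (e j))
    (hd : Pairwise (Function.onFun Disjoint e)) (hE : IsLUB (range e) E) :
    IsReduction (fun a j => q j a) E := by
  refine ⟨fun c => ?_, fun a b => ?_⟩
  · choose d hd' using fun j => (hq j).1 (c j)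
    -- Lifts of the coordinates are cut down to the disjoint elements `e j` and then joined, so they
    -- do not interfere.
    obtain ⟨a, ha⟩ := exists_isLUB_range fun j => d j ⊓ e j
    refine ⟨a, funext fun j => ?_⟩
    rw [← hd']
    apply le_antisymm
    · rw [(hq j).2, inf_comm, inf_le_iff_of_isLUB ha]
      rintro _ ⟨k, rfl⟩
      by_cases hjk : j = k
      · subst hjk
        exact inf_le_right.trans inf_le_left
      · have : e j ⊓ (d k ⊓ e k) ≤ e j ⊓ e k := inf_le_inf_left _ inf_le_right
        exact this.trans ((hd hjk).eq_bot.le.trans bot_le)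
    · rw [(hq j).2]
      exact ha.1 ⟨j, rfl⟩
  · rw [inf_le_iff_of_isLUB hE, Set.forall_mem_range, Pi.le_def]
    exact forall_congr' fun j => (hq j).2 a b

end Reduction

/-! ### The induced action associated with a piece -/

section Piece

variable {G : Type u} [Group G] [TopologicalSpace G] {Ω : Type v} [MeasurableSpace Ω]
  {μ : Measure Ω}

/-- The restriction of an action to a subgroup. -/
noncomputable def restrictAction (π : NonsingularAction G μ) (V : Subgroup G) : NonsingularAction V μ where
  toMonoidHom := (π : G →* AutStar μ).comp V.subtype
  continuous_toFun := π.continuous_toFun.comp continuous_subtype_val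

namespace InducedPiece

variable {π : G →* AutStar μ} (p : InducedPiece π)

/-- The normalized measure with density `|f|²`. -/
noncomputable def probMeasure : Measure Ω :=
  (sqMeasure p.vec Set.univ)⁻¹ • sqMeasure p.vec

theorem sqMeasure_univ_ne_zero : sqMeasure p.vec Set.univ ≠ 0 := fun h => by
  have := (value_sqMeasure_eq_zero_iff p.vec (MeasureAlgebra.mk μ Set.univ MeasurableSet.univ)).1 h
  rw [← top_eq, top_disjoint] at this
  exact suppClass_ne_bot p.vec_ne_zero this

instance isProbabilityMeasure_probMeasure : IsProbabilityMeasure p.probMeasure := by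
  refine ⟨?_⟩
  rw [probMeasure, Measure.smul_apply, smul_eq_mul]
  exact ENNReal.inv_mul_cancel p.sqMeasure_univ_ne_zero (measure_ne_top _ _)

theorem probMeasure_absolutelyContinuous : p.probMeasure ≪ μ :=
  (Measure.smul_absolutelyContinuous).trans (sqMeasure_absolutelyContinuous _)

theorem value_probMeasure (a : MeasureAlgebra μ) :
    value p.probMeasure p.probMeasure_absolutelyContinuous a =
      (sqMeasure p.vec Set.univ)⁻¹ *
        value (sqMeasure p.vec) (sqMeasure_absolutelyContinuous _) a := by
  obtain ⟨s, hs, rfl⟩ := exists_rep a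
  rfl

/-- The null elements of the normalized measure are exactly those disjoint from the support, so its
measure algebra is the part of `μ` below the support. -/
theorem isReduction_project :
    IsReduction (project p.probMeasure_absolutelyContinuous) (suppClass p.vec) := by
  refine ⟨project_surjective _, fun a b => ?_⟩
  rw [project_le_project_iff, value_probMeasure, mul_eq_zero,
    or_iff_right (ENNReal.inv_ne_zero.2 (measure_ne_top _ _)), value_sqMeasure_eq_zero_iff,
    ← disjoint_compl_right_iff, disjoint_iff, disjoint_iff, inf_right_comm]

/-- The reduction to the space of the induced action. -/
noncomputable def toInduced (a : MeasureAlgebra μ) :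
    MeasureAlgebra (inducedMeasure p.subgroup p.probMeasure) :=
  (sigmaEquiv fun _ : G ⧸ p.subgroup => p.probMeasure).symm
    fun x => project p.probMeasure_absolutelyContinuous ((π x.out).symm a)

theorem pairwise_disjoint :
    Pairwise (Function.onFun Disjoint fun x : G ⧸ p.subgroup => π x.out (suppClass p.vec)) := by
  intro x y hxy
  have h : y.out⁻¹ * x.out ∉ p.subgroup := fun h => by
    rw [← QuotientGroup.eq, QuotientGroup.out_eq', QuotientGroup.out_eq'] at h
    exact hxy h.symm
  have := p.disjoint_of_notMem _ h
  rwa [← disjoint_map_orderIso_iff (π y.out), ← RelIso.mul_apply, ← map_mul,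
    mul_inv_cancel_left] at this

theorem isReduction_toInduced [IsTopologicalGroup G] [TopologicalSpace.SeparableSpace G]
    {E : MeasureAlgebra μ}
    (hE : IsLUB (range fun x : G ⧸ p.subgroup => π x.out (suppClass p.vec)) E) :
    IsReduction p.toInduced E := by
  have := countable_quotient_of_isOpen p.isOpen_subgroup
  exact (isReduction_pi (fun x : G ⧸ p.subgroup => p.isReduction_project.comp_orderIso (π x.out))
    p.pairwise_disjoint hE).orderIso_comp (sigmaEquiv _).symm

end InducedPiece

namespace InducedPiece

variable {π : NonsingularAction G μ} (p : InducedPiece (π : G →* AutStar μ))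

/-- The invariant measure. -/
noncomputable def invariantMeasure {ι : Type} (p : ι → InducedPiece (π : G →* AutStar μ)) :
    Measure Ω :=
  Measure.sum fun k : Σ i, G ⧸ (p i).subgroup => sqMeasure (koopman (π k.2.out) (p k.1).vec)

theorem invariantMeasure_absolutelyContinuous {ι : Type}
    (p : ι → InducedPiece (π : G →* AutStar μ)) : invariantMeasure p ≪ μ :=
  Measure.absolutelyContinuous_sum_left fun _ => sqMeasure_absolutelyContinuous _

theorem value_invariantMeasure {ι : Type} (p : ι → InducedPiece (π : G →* AutStar μ))
    (a : MeasureAlgebra μ) :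
    value (invariantMeasure p) (invariantMeasure_absolutelyContinuous p) a =
      ∑' k : Σ i, G ⧸ (p i).subgroup, value (sqMeasure (koopman (π k.2.out) (p k.1).vec))
        (sqMeasure_absolutelyContinuous _) a := by
  obtain ⟨s, hs, rfl⟩ := exists_rep a
  exact Measure.sum_apply _ hs

variable [SigmaFinite μ]

theorem preserves_probMeasure :
    Preserves (restrictAction π p.subgroup : p.subgroup →* AutStar μ) p.probMeasure
      p.probMeasure_absolutelyContinuous := by
  intro g a
  rw [value_probMeasure, value_probMeasure, ← value_sqMeasure_koopman (π (g : G)) p.vec a]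
  have h : koopman (π (g : G)) p.vec = p.vec := p.koopman_vec g g.2
  simp only [h]
  rfl

/-- The action of the subgroup on the probability space of a piece. -/
noncomputable def action : NonsingularAction p.subgroup p.probMeasure :=
  projectNonsingularAction (restrictAction π p.subgroup) p.probMeasure_absolutelyContinuous
    p.preserves_probMeasure

theorem isMeasurePreserving_action :
    IsMeasurePreserving (p.action : p.subgroup →* AutStar p.probMeasure) :=
  isMeasurePreserving_projectAction _ _ p.preserves_probMeasure

theorem action_project (g : p.subgroup) (a : MeasureAlgebra μ) :
    p.action g (project p.probMeasure_absolutelyContinuous a) =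
      project p.probMeasure_absolutelyContinuous (π (g : G) a) :=
  projectAction_project _ _ p.preserves_probMeasure g a

/-- At a coset `x` this reduces to the cocycle identity `x.out⁻¹ g = c (g, g⁻¹ x) (g⁻¹ x).out⁻¹` in
`G`. -/
theorem toInduced_apply (g : G) (a : MeasureAlgebra μ) :
    p.toInduced (π g a) =
      induced p.subgroup (p.action : p.subgroup →* AutStar p.probMeasure) g (p.toInduced a) := by
  apply (sigmaEquiv fun _ : G ⧸ p.subgroup => p.probMeasure).injective
  ext x
  simp only [toInduced, induced, MonoidHom.mk'_apply, OrderIso.trans_apply,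
    OrderIso.apply_symm_apply, inducedPi_apply]
  refine Eq.trans ?_ (p.action_project (cocycle p.subgroup g (g⁻¹ • x)) _).symm
  have h : ∀ (k : G) (b : MeasureAlgebra μ),
      ((π : G →* AutStar μ) k).symm b = (π : G →* AutStar μ) k⁻¹ b := fun k b => by
    rw [map_inv]; rfl
  rw [h, h]
  change project _ (((π : G →* AutStar μ) x.out⁻¹ * (π : G →* AutStar μ) g) a) =
    project _ (((π : G →* AutStar μ) (cocycle p.subgroup g (g⁻¹ • x)) *
      (π : G →* AutStar μ) (g⁻¹ • x).out⁻¹) a)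
  rw [← map_mul, ← map_mul]
  simp only [cocycle, smul_inv_smul, mul_inv_cancel_right]

theorem isomorphic_induced [IsTopologicalGroup G] [TopologicalSpace.SeparableSpace G]
    (hE : IsLUB (range fun x : G ⧸ p.subgroup => π x.out (suppClass p.vec)) ⊤) :
    Isomorphic (π : G →* AutStar μ)
      (induced p.subgroup (p.action : p.subgroup →* AutStar p.probMeasure)) :=
  ⟨(p.isReduction_toInduced hE).orderIso, p.toInduced_apply⟩

theorem isomorphic_disjointUnion [IsTopologicalGroup G] [TopologicalSpace.SeparableSpace G]
    {ι : Type} [Countable ι] (p : ι → InducedPiece (π : G →* AutStar μ))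
    (hd : ∀ i j, i ≠ j → ∀ g, Disjoint (suppClass (p i).vec) (π g (suppClass (p j).vec)))
    (hE : ∀ b, (∀ i g, π g (suppClass (p i).vec) ≤ b) → b = ⊤) :
    Isomorphic (π : G →* AutStar μ) (disjointUnion fun i =>
      induced (p i).subgroup ((p i).action : (p i).subgroup →* AutStar (p i).probMeasure)) := by
  choose e he1 he2 using fun i => (p i).exists_saturation (π : G →* AutStar μ)
  have hdisj : Pairwise (Function.onFun Disjoint e) := by
    intro i j hij
    rw [Function.onFun, ← le_compl_iff_disjoint_right]
    refine (he2 i).2 ?_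
    rintro _ ⟨g, rfl⟩
    rw [le_compl_comm]
    refine (he2 j).2 ?_
    rintro _ ⟨h, rfl⟩
    rw [le_compl_iff_disjoint_left]
    have := hd i j hij (g⁻¹ * h)
    have h2 := (disjoint_map_orderIso_iff ((π : G →* AutStar μ) g)).2 this
    change Disjoint _ (((π : G →* AutStar μ) g * (π : G →* AutStar μ) (g⁻¹ * h)) _) at h2
    rwa [← map_mul, mul_inv_cancel_left] at h2
  have htop : IsLUB (range e) ⊤ := by
    refine ⟨fun _ _ => le_top, fun b hb => (hE b fun i g => ?_).ge⟩
    exact ((he2 i).1 ⟨g, rfl⟩).trans (hb ⟨i, rfl⟩)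
  have hq := (isReduction_pi (fun i => (p i).isReduction_toInduced (he1 i)) hdisj
    htop).orderIso_comp (sigmaEquiv fun i => inducedMeasure (p i).subgroup (p i).probMeasure).symm
  refine ⟨hq.orderIso, fun g a => ?_⟩
  rw [hq.orderIso_apply, hq.orderIso_apply]
  simp only [disjointUnion, MonoidHom.mk'_apply, OrderIso.trans_apply, OrderIso.apply_symm_apply]
  congr 1
  funext i
  exact (p i).toInduced_apply g a

/-! ### Properties of the invariant measure. -/

theorem koopman_out_smul (g : G) (x : G ⧸ p.subgroup) :
    koopman (π (g • x).out) p.vec = koopman (π g) (koopman (π x.out) p.vec) := by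
  have h := rep_out_eq ((koopmanHom μ).comp (π : G →* AutStar μ)) p.koopman_vec (g * x.out)
  rw [rep_mul_apply] at h
  refine Eq.trans ?_ h
  have : g • x = ((g * x.out : G) : G ⧸ p.subgroup) := by
    conv_lhs => rw [← QuotientGroup.out_eq' x]
    rfl
  rw [this]
  rfl

/-- Each `g` permutes the translated vectors, so it only reorders the terms of the sum. -/
theorem preserves_invariantMeasure {ι : Type} (p : ι → InducedPiece (π : G →* AutStar μ)) :
    Preserves (π : G →* AutStar μ) (invariantMeasure p)
      (invariantMeasure_absolutelyContinuous p) := by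
  intro g a
  rw [value_invariantMeasure, value_invariantMeasure]
  let σ : (Σ i, G ⧸ (p i).subgroup) ≃ Σ i, G ⧸ (p i).subgroup :=
    Equiv.sigmaCongrRight fun i => MulAction.toPerm g
  rw [← σ.tsum_eq]
  refine tsum_congr fun k => ?_
  have h : koopman (π (σ k).2.out) (p (σ k).1).vec =
      koopman (π g) (koopman (π k.2.out) (p k.1).vec) := (p k.1).koopman_out_smul g k.2
  simp only [h]
  exact value_sqMeasure_koopman (π g) _ a

/-- A null set of the sum is disjoint from every translated support, and these supports exhaust the
algebra. -/
theorem absolutelyContinuous_invariantMeasure {ι : Type}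
    (p : ι → InducedPiece (π : G →* AutStar μ))
    (hE : ∀ b, (∀ i g, π g (suppClass (p i).vec) ≤ b) → b = ⊤) : μ ≪ invariantMeasure p := by
  refine Measure.AbsolutelyContinuous.mk fun s hs h => ?_
  have h1 := value_invariantMeasure p (MeasureAlgebra.mk μ s hs)
  rw [value_mk, h, eq_comm, ENNReal.tsum_eq_zero] at h1
  have h2 : (MeasureAlgebra.mk μ s hs)ᶜ = ⊤ := hE _ fun i g => by
    have := h1 ⟨i, (g : G ⧸ (p i).subgroup)⟩
    rw [value_sqMeasure_eq_zero_iff, suppClass_koopman] at this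
    have h3 := (p i).apply_out (π : G →* AutStar μ) g
    change Disjoint _ ((π : G →* AutStar μ) _ _) at this
    rw [h3] at this
    exact le_compl_iff_disjoint_left.2 this
  rw [compl_eq_top, bot_eq, mk_eq_mk] at h2
  exact ae_eq_empty.1 h2

/-- The translated supports are pairwise disjoint and countable in number, so at almost every point
at most one term of the density is nonzero. The density is thus finite almost everywhere, which
suffices since `μ` is σ-finite. -/
theorem sigmaFinite_invariantMeasure [IsTopologicalGroup G] [TopologicalSpace.SeparableSpace G]
    {ι : Type} [Countable ι] (p : ι → InducedPiece (π : G →* AutStar μ))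
    (hd : ∀ i j, i ≠ j → ∀ g, Disjoint (suppClass (p i).vec) (π g (suppClass (p j).vec))) :
    SigmaFinite (invariantMeasure p) := by
  have hc := fun i => countable_quotient_of_isOpen (p i).isOpen_subgroup
  let K := Σ i, G ⧸ (p i).subgroup
  let ξ : K → Lp ℂ 2 μ := fun k => koopman (π k.2.out) (p k.1).vec
  have hdisj : ∀ k l : K, k ≠ l → Disjoint (suppClass (ξ k)) (suppClass (ξ l)) := by
    rintro ⟨i, x⟩ ⟨j, y⟩ hkl
    simp only [ξ, suppClass_koopman]
    by_cases hij : i = j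
    · subst hij
      exact (p i).pairwise_disjoint fun h => hkl (by rw [h])
    · have := hd i j hij (x.out⁻¹ * y.out)
      have h2 := (disjoint_map_orderIso_iff ((π : G →* AutStar μ) x.out)).2 this
      change Disjoint _ (((π : G →* AutStar μ) x.out * (π : G →* AutStar μ) (x.out⁻¹ * y.out)) _)
        at h2
      rwa [← map_mul, mul_inv_cancel_left] at h2
  have hae : ∀ᵐ x ∂μ, ∀ k l : K, k ≠ l → ξ k x ≠ 0 → ξ l x = 0 := by
    refine ae_all_iff.2 fun k => ae_all_iff.2 fun l => ?_
    by_cases hkl : k = l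
    · exact Eventually.of_forall fun x h => absurd hkl h
    · have := hdisj k l hkl
      rw [disjoint_iff, suppClass, suppClass, mk_inf_mk, bot_eq, mk_eq_mk, ae_eq_empty,
        measure_eq_zero_iff_ae_notMem] at this
      filter_upwards [this] with x hx _ h1
      by_contra h2
      exact hx ⟨h1, h2⟩
  have heq : invariantMeasure p = μ.withDensity (∑' k : K, fun x => ‖ξ k x‖ₑ ^ (2 : ℝ)) :=
    (withDensity_tsum fun k => measurable_enorm_sq (ξ k)).symm
  rw [heq]
  refine SigmaFinite.withDensity_of_ne_top ?_
  filter_upwards [hae] with x hx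
  rw [tsum_apply (Pi.summable.2 fun _ => ENNReal.summable)]
  by_cases h : ∃ k, ξ k x ≠ 0
  · obtain ⟨k, hk⟩ := h
    rw [tsum_eq_single k fun l hl => by rw [hx k l hl.symm hk]; simp]
    exact ENNReal.rpow_ne_top_of_nonneg zero_le_two enorm_ne_top
  · push Not at h
    simp [h]

end InducedPiece

end Piece

end NonsingularActions

/-! ### The theorem. -/

theorem mainTheorem1 {G : Type u} [Group G] [TopologicalSpace G] [NonarchimedeanGroup G]
    [PolishSpace G] (hG : IsRoelckePrecompact G) {Ω : Type v} [MeasurableSpace Ω]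
    (μ : Measure Ω) [SigmaFinite μ] (π : NonsingularAction G μ) :
    (∃ (ι : Type) (_ : Countable ι) (V : ι → Subgroup G) (Ω' : ι → Type v)
        (_ : ∀ i, MeasurableSpace (Ω' i)) (ν : ∀ i, Measure (Ω' i))
        (α : ∀ i, NonsingularAction (V i) (ν i)),
      (∀ i, IsOpen (V i : Set G) ∧ IsSelfCommensurating (V i) ∧
        IsProbabilityMeasure (ν i) ∧ IsMeasurePreserving (α i : V i →* AutStar (ν i))) ∧
      Isomorphic (π : G →* AutStar μ)
        (disjointUnion fun i => induced (V i) (α i : V i →* AutStar (ν i)))) ∧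
    (∃ (ν : Measure Ω) (hν : ν ≪ μ), SigmaFinite ν ∧ μ ≪ ν ∧
      Preserves (π : G →* AutStar μ) ν hν) ∧
    (∃ (Ω' : Type v) (_ : MeasurableSpace Ω') (ν : Measure Ω') (ρ : NonsingularAction G ν),
      SigmaFinite ν ∧ IsMeasurePreserving (ρ : G →* AutStar ν) ∧
      Isomorphic (π : G →* AutStar μ) (ρ : G →* AutStar ν)) ∧
    (μ ≠ 0 → IsErgodic (π : G →* AutStar μ) →
      ∃ (V : Subgroup G) (Ω' : Type v) (_ : MeasurableSpace Ω') (ν : Measure Ω')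
        (α : NonsingularAction V ν),
        IsOpen (V : Set G) ∧ IsSelfCommensurating V ∧ IsProbabilityMeasure ν ∧
        IsMeasurePreserving (α : V →* AutStar ν) ∧
        Isomorphic (π : G →* AutStar μ) (induced V (α : V →* AutStar ν))) := by
  obtain ⟨ι, hι, p, hd, hE⟩ := exists_exhaustion hG π
  have hσ := InducedPiece.sigmaFinite_invariantMeasure p hd
  have hpres := InducedPiece.preserves_invariantMeasure p
  refine ⟨⟨ι, hι, fun i => (p i).subgroup, fun _ => Ω, fun _ => inferInstance,
    fun i => (p i).probMeasure, fun i => (p i).action, fun i => ⟨(p i).isOpen_subgroup,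
      (p i).selfCommensurating, inferInstance, (p i).isMeasurePreserving_action⟩,
    InducedPiece.isomorphic_disjointUnion p hd hE⟩,
    ⟨InducedPiece.invariantMeasure p, InducedPiece.invariantMeasure_absolutelyContinuous p, hσ,
      InducedPiece.absolutelyContinuous_invariantMeasure p hE, hpres⟩,
    ⟨Ω, inferInstance, InducedPiece.invariantMeasure p, projectNonsingularAction π _ hpres, hσ,
      isMeasurePreserving_projectAction _ _ hpres,
      MeasureAlgebra.projectIso (InducedPiece.invariantMeasure_absolutelyContinuous p)
        (InducedPiece.absolutelyContinuous_invariantMeasure p hE),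
      fun g a => (projectAction_project _ _ hpres g a).symm⟩, fun hμ herg => ?_⟩
  have hι : Nonempty ι := by
    by_contra hne
    rw [not_nonempty_iff] at hne
    -- With no pieces, exhaustion applied to `⊥` says that the measure algebra is trivial, against
    -- `μ ≠ 0`.
    have := hE ⊥ fun i => hne.elim i
    rw [MeasureAlgebra.bot_eq, MeasureAlgebra.top_eq, MeasureAlgebra.mk_eq_mk] at this
    exact hμ (Measure.measure_univ_eq_zero.1 (ae_eq_empty.1 this.symm))
  obtain ⟨i⟩ := hι
  obtain ⟨e, he1, he2⟩ := (p i).exists_saturation (π : G →* AutStar μ)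
  have he3 : IsLUB (range fun q : G × Unit =>
      (π : G →* AutStar μ) q.1 (suppClass (p i).vec)) e := by
    convert he2 using 1
    exact Set.ext fun a => ⟨fun ⟨q, hq⟩ => ⟨q.1, hq⟩, fun ⟨g, hg⟩ => ⟨(g, ()), hg⟩⟩
  -- The saturation of a single piece is invariant and nonzero, so by ergodicity this piece alone
  -- exhausts the algebra.
  have htop : e = ⊤ := by
    refine (herg e fun g => apply_eq_of_isLUB_orbit (π : G →* AutStar μ)
      (a := fun _ : Unit => suppClass (p i).vec) he3 g).resolve_left fun hbot => ?_
    have h1 : (π : G →* AutStar μ) 1 (suppClass (p i).vec) ≤ e := he2.1 ⟨1, rfl⟩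
    rw [map_one, hbot, le_bot_iff] at h1
    exact suppClass_ne_bot (p i).vec_ne_zero h1
  exact ⟨(p i).subgroup, Ω, inferInstance, (p i).probMeasure, (p i).action,
    (p i).isOpen_subgroup, (p i).selfCommensurating, inferInstance,
    (p i).isMeasurePreserving_action, (p i).isomorphic_induced (htop ▸ he1)⟩
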